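/- **Setting.** Let $n\ge 1$, let $\Xi$ be a set and $A:\Xi\to\mathbb{R}^{n\times n}$, let $\xi_1,\dots,\xi_m\in\Xi$ be such that the matrices $A(\xi_1),\dots,A(\xi_m)$ are invertible, and put $Y_m=\mathrm{span}\{A(\xi_1)^{-1},\dots,A(\xi_m)^{-1}\}\subset\mathbb{R}^{n\times n}$. Let $V$ be a random matrix in $\mathbb{R}^{n\times K}$ and, for $\xi\in\Xi$, let $$P_m(\xi)\in\underset{P\in Y_m}{\mathrm{argmin}}\ \|(I-PA(\xi))V\|_F ,$$ where $\|\cdot\|_F$ is the Frobenius norm. The *rescaled Rademacher distribution* on $\mathbb{R}^{n\times K}$ is the law of a matrix whose entries are independent and equal to $\pm K^{-1/2}$ with probability $1/2$ each. The *P-SRHT distribution* on $\mathbb{R}^{n\times K}$ is the law of the first $n$ rows of $K^{-1/2}(RHD)^T$, where $s=2^{\lceil\log_2 n\rceil}$, $H\in\mathbb{R}^{s\times s}$ is a Hadamard matrix (entries $\pm1$, $HH^T=sI$), $D\in\mathbb{R}^{s\times s}$ is diagonal with independent entries equal to $\pm1$ with probability $1/2$ each, and $R\in\mathbb{R}^{K\times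 s}$, independent of $D$, consists of $K\le s$ rows of the identity matrix chosen uniformly at random without replacement. **Proposition.** Let $\xi\in\Xi$, $0<\varepsilon\le1$, $\delta>0$, $C>1$ be such that $\varepsilon':=\varepsilon(C+1)/(C-1)<1$. Assume that either $V$ has the rescaled Rademacher distribution with $$K\ge 6\varepsilon^{-2}\ln\bigl(2n(9C/\varepsilon)^{m+1}/\delta\bigr),$$ or $V$ has the P-SRHT distribution with $$K\ge 2(\varepsilon^2-\varepsilon^3/3)^{-1}\ln\bigl(4(9C/\varepsilon)^{m+1}/\delta\bigr)\Bigl(1+\sqrt{8\ln\bigl(4n(9C/\varepsilon)^{m+1}/\delta\bigr)}\Bigr)^2 .$$ Then, with probability at least $1-\delta$, the following holds for every minimizer $P_m(\xi)$: $$(1-\alpha_m(\xi))^2(1-\varepsilon')\ \le\ \|(I-P_m(\xi)A(\xi))V\|_F^2\ \le\ n\bigl(1-(1-\varepsilon')\alpha_m(\xi)^2\bigr)$$ and $$\kappa(P_m(\xi)A(\xi))\ \le\ \alpha_m(\xi)^{-1}\sqrt{n(1-\varepsilon')^{-1}-(n-1)\alpha_m(\xi)^2},$$ where $\alpha_m(\xi)$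 is the lowest singular value of $P_m(\xi)A(\xi)$ and $\kappa$ is the ratio of the largest to the lowest singular value (both sides of the last inequality being $+\infty$ if $\alpha_m(\xi)=0$). -/

import Mathlib

open MeasureTheory ProbabilityTheory

-- In what follows `‖M‖` is the Frobenius norm of a real (rectangular) matrix `M`.
open scoped Matrix.Norms.Frobenius

/-- The largest singular value of a square matrix (for `n ≥ 1`). -/
noncomputable def largestSingularValue {n : ℕ} (M : Matrix (Fin n) (Fin n) ℝ) : ℝ :=
  (Matrix.toEuclideanLin M).singularValues 0

/-- The lowest singular value of a square matrix (for `n ≥ 1`); Mathlib lists the singular values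
in decreasing order, with indices starting at `0`. -/
noncomputable def lowestSingularValue {n : ℕ} (M : Matrix (Fin n) (Fin n) ℝ) : ℝ :=
  (Matrix.toEuclideanLin M).singularValues (n - 1)

open Classical in
/-- The condition number `κ(M)`, the ratio of the largest to the lowest singular value. It is `∞`
if the lowest singular value is zero. -/
noncomputable def conditionNumber {n : ℕ} (M : Matrix (Fin n) (Fin n) ℝ) : ENNReal :=
  if lowestSingularValue M = 0 then ⊤
  else ENNReal.ofReal (largestSingularValue M / lowestSingularValue M)

/-- `X` takes the values `a` and `-a` with probability `1/2` each (used with `a > 0`). -/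
structure IsSymmetricSign {Ω : Type*} [MeasurableSpace Ω] (μ : Measure Ω) (a : ℝ)
    (X : Ω → ℝ) : Prop where
  aemeasurable : AEMeasurable X μ
  prob_pos : μ {ω | X ω = a} = 1 / 2
  prob_neg : μ {ω | X ω = -a} = 1 / 2

/-- The random matrix `V` has the rescaled Rademacher distribution over `ℝ^{n × K}`: its entries
are independent and equal to `±K^{-1/2}` with probability `1/2`. -/
structure IsRescaledRademacher {Ω : Type*} [MeasurableSpace Ω] (μ : Measure Ω) {n K : ℕ}
    (V : Ω → Matrix (Fin n) (Fin K) ℝ) : Prop where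
  sign : ∀ i j, IsSymmetricSign μ (√(K : ℝ))⁻¹ (fun ω => V ω i j)
  indep : iIndepFun (fun (p : Fin n × Fin K) (ω : Ω) => V ω p.1 p.2) μ

/-- The smallest power of two that is at least `n`, that is `2 ^ ⌈log₂ n⌉`. -/
def hadamardSize (n : ℕ) : ℕ := 2 ^ Nat.clog 2 n

theorem le_hadamardSize (n : ℕ) : n ≤ hadamardSize n := Nat.le_pow_clog Nat.one_lt_two n

/-- The random matrix `V` has the partial subsampled randomized Hadamard transform (P-SRHT)
distribution over `ℝ^{n × K}`: it consists of the first `n` rows of `K^{-1/2} (R H D)ᵀ`, where,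
with `s = 2 ^ ⌈log₂ n⌉`,
* `H` is a (deterministic) Hadamard matrix of size `s`,
* `D` is the diagonal matrix of independent signs `d i`,
* `R` consists of the rows `r 0, …, r (K - 1)` of the identity matrix of size `s`, whose set is
  uniformly distributed among the sets of `K` rows (the order in which the chosen rows are listed
  is immaterial), and which are independent of `d`.
If `n` is a power of two this is the SRHT distribution. -/
def IsPSRHT {Ω : Type*} [MeasurableSpace Ω] (μ : Measure Ω) {n K : ℕ}
    (V : Ω → Matrix (Fin n) (Fin K) ℝ) : Prop :=
  ∃ (H : Matrix (Fin (hadamardSize n)) (Fin (hadamardSize n)) ℝ)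
    (d : Ω → Fin (hadamardSize n) → ℝ) (r : Ω → Fin K → Fin (hadamardSize n)),
    H.IsHadamard ∧
    (∀ i, IsSymmetricSign μ 1 (fun ω => d ω i)) ∧
    iIndepFun (fun i ω => d ω i) μ ∧
    AEMeasurable r μ ∧
    K ≤ hadamardSize n ∧
    (∀ S : Finset (Fin (hadamardSize n)), S.card = K →
      μ {ω | Finset.univ.image (r ω) = S} = 1 / ((hadamardSize n).choose K : ENNReal)) ∧
    IndepFun d r μ ∧
    ∀ᵐ ω ∂μ, V ω =
      ((√(K : ℝ))⁻¹ •
        (((1 : Matrix (Fin (hadamardSize n)) (Fin (hadamardSize n)) ℝ).submatrix (r ω) id)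
          * H * Matrix.diagonal (d ω)).transpose).submatrix (Fin.castLE (le_hadamardSize n)) id

/-- The subspace `Y_m = span {A(ξ₁)⁻¹, …, A(ξₘ)⁻¹}` of `ℝ^{n × n}`. -/
noncomputable def inverseSpan {Ξ : Type*} {n m : ℕ} (A : Ξ → Matrix (Fin n) (Fin n) ℝ)
    (pts : Fin m → Ξ) : Submodule ℝ (Matrix (Fin n) (Fin n) ℝ) :=
  Submodule.span ℝ (Set.range fun i => (A (pts i))⁻¹)

/-- `P` is a minimizer over `Q ∈ Y` of the Frobenius semi-norm `‖(I - Q B) V‖_F`. -/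
def IsSemiNormProjection {n K : ℕ} (Y : Submodule ℝ (Matrix (Fin n) (Fin n) ℝ))
    (B : Matrix (Fin n) (Fin n) ℝ) (V : Matrix (Fin n) (Fin K) ℝ)
    (P : Matrix (Fin n) (Fin n) ℝ) : Prop :=
  P ∈ Y ∧ ∀ Q ∈ Y, ‖(1 - P * B) * V‖ ≤ ‖(1 - Q * B) * V‖

/-! Put `B = A ξ`. Both `P * B` and `1 - P * B` lie in the span `W` of `1` and the products `(A (pts
i))⁻¹ * B`, a space of dimension at most `m + 1`. Once `(1 - ε') * ‖X‖ ^ 2 ≤ ‖X * V‖ ^ 2` holds for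
every `X` in `W`, the rest is deterministic (`IsSemiNormProjection.bounds`). Optimality of `P` among
its own multiples gives `‖(1 - P * B) * V‖ ^ 2 + ‖P * B * V‖ ^ 2 ≤ ‖V‖ ^ 2`, and `‖V‖ ^ 2 = n`
almost surely. The squared Frobenius norm is the sum of the squared singular values, hence controls
the lowest and the largest one.

The embedding property on `W` comes from a net of its unit sphere and a union bound
(`measure_bounds_of_tail`). Only the lower bound on the net has to be sharp. The upper bound merely
controls the operator norm of `X ↦ X * V`, so the crude factor `9` suffices. The mesh `ε / (4 * C)`
accounts both for the cardinality `(9 * C / ε) ^ (m + 1)` and for the loss from `ε` to `ε'`.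

What remains is a tail bound for one fixed matrix `M`. In the Rademacher case each row of `M` is
treated by Chernoff's method: the lower tail uses second and fourth moments, the upper tail the
exponential moment of a squared sub-Gaussian variable. In the P-SRHT case the random signs flatten
the transformed matrix with high probability. With the signs fixed, the sampled norm is a sum over a
uniform `K`-subset, and Maclaurin's inequality yields the Chernoff bound for sampling without
replacement. -/

theorem Matrix.frobenius_norm_sq {a b : Type*} [Fintype a] [Fintype b] (M : Matrix a b ℝ) :
    ‖M‖ ^ 2 = ∑ i, ∑ j, M i j ^ 2 := by
  rw [Matrix.frobenius_norm_def, ← Real.sqrt_eq_rpow, Real.sq_sqrt]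
  · simp
  · positivity

/-! ### Singular values and the Frobenius norm. -/

section SingularValues

variable {n : ℕ} (M : Matrix (Fin n) (Fin n) ℝ)

/-- Both sides are the trace of `Mᴴ * M`: its eigenvalues are the squared singular values, and its
diagonal entries are the squared norms of the columns. -/
theorem sum_sq_singularValues :
    ∑ i : Fin n, (Matrix.toEuclideanLin M).singularValues i ^ 2 = ‖M‖ ^ 2 := by
  have hn : Module.finrank ℝ (EuclideanSpace ℝ (Fin n)) = n := finrank_euclideanSpace_fin
  simp_rw [LinearMap.sq_singularValues_fin _ hn]
  have h := (Matrix.toEuclideanLin M).isSymmetric_adjoint_comp_self.trace_eq_sum_eigenvalues hn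
  simp only [RCLike.ofReal_real_eq_id, id] at h
  rw [← h, ← Matrix.toEuclideanLin_conjTranspose_eq_adjoint]
  have : (Matrix.toEuclideanLin M.conjTranspose) ∘ₗ (Matrix.toEuclideanLin M) =
      Matrix.toEuclideanLin (M.conjTranspose * M) := by
    ext1 v
    simp [Matrix.toLpLin_apply, Matrix.mulVec_mulVec]
  rw [this, Matrix.toEuclideanLin, Matrix.toLpLin_eq_toLin, Matrix.trace_toLin_eq,
    Matrix.frobenius_norm_sq, Finset.sum_comm]
  simp [Matrix.trace, Matrix.mul_apply, sq]

theorem lowestSingularValue_nonneg : 0 ≤ lowestSingularValue M :=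
  LinearMap.singularValues_nonneg _ _

theorem lowestSingularValue_le (i : Fin n) :
    lowestSingularValue M ≤ (Matrix.toEuclideanLin M).singularValues i :=
  LinearMap.singularValues_antitone _ (by omega)

/-- The lowest singular value is attained by a unit vector. -/
theorem exists_norm_eq_lowestSingularValue (hn : 1 ≤ n) :
    ∃ v : EuclideanSpace ℝ (Fin n), ‖v‖ = 1 ∧
      ‖Matrix.toEuclideanLin M v‖ = lowestSingularValue M := by
  have hfin : Module.finrank ℝ (EuclideanSpace ℝ (Fin n)) = n := finrank_euclideanSpace_fin
  set T := Matrix.toEuclideanLin M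
  have hsymm := T.isSymmetric_adjoint_comp_self
  let i : Fin n := ⟨n - 1, by omega⟩
  refine ⟨hsymm.eigenvectorBasis hfin i, (hsymm.eigenvectorBasis hfin).orthonormal.1 i, ?_⟩
  set v := hsymm.eigenvectorBasis hfin i with hv
  have hev := hsymm.apply_eigenvectorBasis hfin i
  have h1 : ‖T v‖ ^ 2 = lowestSingularValue M ^ 2 := by
    rw [← real_inner_self_eq_norm_sq, ← LinearMap.adjoint_inner_left, ← LinearMap.comp_apply, hev,
      inner_smul_left, real_inner_self_eq_norm_sq, (hsymm.eigenvectorBasis hfin).orthonormal.1 i,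
      ← T.sq_singularValues_fin hfin i]
    simp [lowestSingularValue, T, i]
  exact (sq_eq_sq₀ (norm_nonneg _) (lowestSingularValue_nonneg M)).1 h1

theorem norm_toEuclideanLin_le (v : EuclideanSpace ℝ (Fin n)) :
    ‖Matrix.toEuclideanLin M v‖ ≤ ‖M‖ * ‖v‖ := by
  refine le_of_sq_le_sq ?_ (by positivity)
  rw [mul_pow, EuclideanSpace.norm_sq_eq, EuclideanSpace.norm_sq_eq, Matrix.frobenius_norm_sq,
    Finset.sum_mul]
  refine Finset.sum_le_sum fun i _ => ?_
  simp only [Matrix.ofLp_toLpLin, Matrix.toLin'_apply, Real.norm_eq_abs, sq_abs, Matrix.mulVec, dotProduct]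
  exact Finset.sum_mul_sq_le_sq_mul_sq _ _ _

/-- A unit vector `v` with `‖M v‖` equal to the lowest singular value satisfies `‖v - M v‖ ≥ |1 - ‖M
v‖|`, and the Frobenius norm dominates the operator norm. -/
theorem sq_one_sub_lowestSingularValue_le (hn : 1 ≤ n) :
    (1 - lowestSingularValue M) ^ 2 ≤ ‖1 - M‖ ^ 2 := by
  obtain ⟨v, hv, hMv⟩ := exists_norm_eq_lowestSingularValue M hn
  have h := norm_toEuclideanLin_le (1 - M) v
  have hsub : Matrix.toEuclideanLin (1 - M) v = v - Matrix.toEuclideanLin M v := by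
    simp [Matrix.toLpLin_apply]
  rw [hv, mul_one, hsub] at h
  rw [← sq_abs, ← hv, ← hMv]
  exact pow_le_pow_left₀ (abs_nonneg _) ((abs_norm_sub_norm_le _ _).trans h) 2

theorem mul_sq_lowestSingularValue_le : n * lowestSingularValue M ^ 2 ≤ ‖M‖ ^ 2 := by
  rw [← sum_sq_singularValues]
  calc n * lowestSingularValue M ^ 2 = ∑ _i : Fin n, lowestSingularValue M ^ 2 := by simp
    _ ≤ _ := Finset.sum_le_sum fun i _ =>
      pow_le_pow_left₀ (lowestSingularValue_nonneg M) (lowestSingularValue_le M i) 2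

theorem sq_largestSingularValue_add_le (hn : 1 ≤ n) :
    largestSingularValue M ^ 2 + (n - 1) * lowestSingularValue M ^ 2 ≤ ‖M‖ ^ 2 := by
  obtain ⟨k, rfl⟩ : ∃ k, n = k + 1 := ⟨n - 1, by omega⟩
  rw [← sum_sq_singularValues, Fin.sum_univ_succ]
  have : ((k + 1 : ℕ) - 1 : ℝ) * lowestSingularValue M ^ 2 =
      ∑ _i : Fin k, lowestSingularValue M ^ 2 := by simp
  rw [this]
  exact add_le_add le_rfl (Finset.sum_le_sum fun i _ =>
    pow_le_pow_left₀ (lowestSingularValue_nonneg M) (lowestSingularValue_le M i.succ) 2)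

end SingularValues

/-! ### Deterministic consequences of minimality. -/

section Minimizer

variable {n K : ℕ}

/-- Pythagorean inequality for a minimizer of the Frobenius semi-norm. -/
theorem IsSemiNormProjection.norm_sq_add_norm_sq_le
    {Y : Submodule ℝ (Matrix (Fin n) (Fin n) ℝ)} {B P : Matrix (Fin n) (Fin n) ℝ}
    {V : Matrix (Fin n) (Fin K) ℝ} (h : IsSemiNormProjection Y B V P) :
    ‖(1 - P * B) * V‖ ^ 2 + ‖P * B * V‖ ^ 2 ≤ ‖V‖ ^ 2 := by
  set U := P * B * V with hU
  let c : ℝ := ∑ i, ∑ j, V i j * U i j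
  have expand : ∀ t : ℝ, ‖(1 - (t • P) * B) * V‖ ^ 2 = ‖V‖ ^ 2 - 2 * t * c + t ^ 2 * ‖U‖ ^ 2 := by
    intro t
    have : (1 - (t • P) * B) * V = V - t • U := by
      rw [Matrix.sub_mul, Matrix.one_mul, Matrix.smul_mul, Matrix.smul_mul]
    rw [this]
    simp only [Matrix.frobenius_norm_sq, c, Finset.mul_sum, ← Finset.sum_sub_distrib,
      ← Finset.sum_add_distrib]
    refine Finset.sum_congr rfl fun i _ => Finset.sum_congr rfl fun j _ => ?_
    simp only [Matrix.sub_apply, Matrix.smul_apply, smul_eq_mul]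
    ring
  have h1 := expand 1
  rw [one_smul] at h1
  -- Competitors `t • P` suffice: the squared residual is a quadratic in `t` that is smallest at `t
  -- = 1`.
  have hmin : ∀ t : ℝ, ‖V‖ ^ 2 - 2 * 1 * c + 1 ^ 2 * ‖U‖ ^ 2 ≤
      ‖V‖ ^ 2 - 2 * t * c + t ^ 2 * ‖U‖ ^ 2 := by
    intro t
    rw [← expand t, ← h1]
    exact pow_le_pow_left₀ (norm_nonneg _) (h.2 _ (Y.smul_mem t h.1)) 2
  have hc : ‖U‖ ^ 2 ≤ c := by
    have hD : 0 ≤ ‖U‖ ^ 2 := sq_nonneg _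
    rcases hD.eq_or_lt with hD | hD
    · rw [← hD] at hmin ⊢
      nlinarith [hmin 2, hmin 0]
    -- At the vertex of the quadratic, the comparison becomes `(c - ‖U‖ ^ 2) ^ 2 ≤ 0`.
    · have := hmin (c / ‖U‖ ^ 2)
      have e : ‖V‖ ^ 2 - 2 * (c / ‖U‖ ^ 2) * c + (c / ‖U‖ ^ 2) ^ 2 * ‖U‖ ^ 2 =
          ‖V‖ ^ 2 - c ^ 2 / ‖U‖ ^ 2 := by
        field_simp
        ring
      rw [e] at this
      have h3 : c ^ 2 / ‖U‖ ^ 2 ≤ 2 * c - ‖U‖ ^ 2 := by linarith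
      rw [div_le_iff₀ hD] at h3
      nlinarith [sq_nonneg (c - ‖U‖ ^ 2)]
  rw [h1]
  linarith

/-- The bounds on the residual and on the condition number hold as soon as the random embedding
does not shrink the residual and the preconditioned matrix too much. -/
theorem IsSemiNormProjection.bounds {Y : Submodule ℝ (Matrix (Fin n) (Fin n) ℝ)}
    {B P : Matrix (Fin n) (Fin n) ℝ} {V : Matrix (Fin n) (Fin K) ℝ} {ε' : ℝ}
    (h : IsSemiNormProjection Y B V P) (hn : 1 ≤ n) (hε' : ε' < 1) (hV : ‖V‖ ^ 2 = n)
    (h1 : (1 - ε') * ‖1 - P * B‖ ^ 2 ≤ ‖(1 - P * B) * V‖ ^ 2)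
    (h2 : (1 - ε') * ‖P * B‖ ^ 2 ≤ ‖P * B * V‖ ^ 2) :
    (1 - lowestSingularValue (P * B)) ^ 2 * (1 - ε') ≤ ‖(1 - P * B) * V‖ ^ 2 ∧
      ‖(1 - P * B) * V‖ ^ 2 ≤ n * (1 - (1 - ε') * lowestSingularValue (P * B) ^ 2) ∧
      conditionNumber (P * B) ≤ (ENNReal.ofReal (lowestSingularValue (P * B)))⁻¹ *
        ENNReal.ofReal √(n * (1 - ε')⁻¹ - (n - 1) * lowestSingularValue (P * B) ^ 2) := by
  have hpos : 0 < 1 - ε' := by linarith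
  have hpyth := h.norm_sq_add_norm_sq_le
  rw [hV] at hpyth
  refine ⟨?_, ?_, ?_⟩
  · have := mul_le_mul_of_nonneg_right (sq_one_sub_lowestSingularValue_le (P * B) hn) hpos.le
    linarith
  · have := mul_le_mul_of_nonneg_left (mul_sq_lowestSingularValue_le (P * B)) hpos.le
    linarith
  · have hnorm : ‖P * B‖ ^ 2 ≤ n * (1 - ε')⁻¹ := by
      rw [← div_eq_mul_inv, le_div_iff₀ hpos]
      nlinarith [sq_nonneg ‖(1 - P * B) * V‖]
    have hnR : (1 : ℝ) ≤ n := by exact_mod_cast hn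
    unfold conditionNumber
    split_ifs with h0
    -- The right side is `⊤` times a square root; since `⊤ * 0 = 0`, the root has to be shown
    -- nonzero.
    · rw [h0, ENNReal.ofReal_zero, ENNReal.inv_zero, ENNReal.top_mul]
      rw [ne_eq, ENNReal.ofReal_eq_zero, not_le, Real.sqrt_pos]
      have : 0 < n * (1 - ε')⁻¹ := by positivity
      simpa using this
    · have hα : 0 < lowestSingularValue (P * B) :=
        lt_of_le_of_ne (lowestSingularValue_nonneg _) (Ne.symm h0)
      rw [← ENNReal.ofReal_inv_of_pos hα, ← ENNReal.ofReal_mul (by positivity)]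
      refine ENNReal.ofReal_le_ofReal ?_
      rw [div_eq_inv_mul]
      refine mul_le_mul_of_nonneg_left (Real.le_sqrt_of_sq_le ?_) (by positivity)
      linarith [sq_largestSingularValue_add_le (P * B) hn]

end Minimizer

/-! ### Nets of the unit sphere. -/

section Net

variable {E : Type*} [NormedAddCommGroup E] [NormedSpace ℝ E] [FiniteDimensional ℝ E]

open Metric Module in
open scoped Function in
/-- Volume bound for the cardinality of an `η`-separated subset of the unit ball. -/
theorem card_le_of_separated_of_norm_le_one {η : ℝ} (hη : 0 < η) (s : Finset E)
    (hs : ∀ c ∈ s, ‖c‖ ≤ 1) (h : ∀ c ∈ s, ∀ d ∈ s, c ≠ d → η ≤ ‖c - d‖) :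
    (s.card : ℝ) ≤ (1 + 2 / η) ^ finrank ℝ E := by
  borelize E
  let μ : Measure E := Measure.addHaar
  have δpos : 0 < η / 2 := by positivity
  have ρpos : 0 < 1 + η / 2 := by positivity
  -- The balls of radius `η / 2` are disjoint and lie in the ball of radius `1 + η / 2`; the bound
  -- is the ratio of volumes.
  have D : Set.Pairwise (s : Set E) (Disjoint on fun c => ball (c : E) (η / 2)) := by
    rintro c hc d hd hcd
    apply ball_disjoint_ball
    rw [dist_eq_norm]
    linarith [h c hc d hd hcd]
  have A_subset : (⋃ c ∈ s, ball (c : E) (η / 2)) ⊆ ball (0 : E) (1 + η / 2) := by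
    refine Set.iUnion₂_subset fun x hx => ball_subset_ball' ?_
    rw [dist_zero_right]
    linarith [hs x hx]
  have I : (s.card : ENNReal) * ENNReal.ofReal ((η / 2) ^ finrank ℝ E) * μ (ball 0 1) ≤
      ENNReal.ofReal ((1 + η / 2) ^ finrank ℝ E) * μ (ball 0 1) :=
    calc
      _ = μ (⋃ c ∈ s, ball (c : E) (η / 2)) := by
        rw [measure_biUnion_finset D fun c _ => measurableSet_ball]
        simp only [μ.addHaar_ball_of_pos _ δpos, Finset.sum_const, nsmul_eq_mul, mul_assoc]
      _ ≤ μ (ball (0 : E) (1 + η / 2)) := measure_mono A_subset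
      _ = _ := μ.addHaar_ball_of_pos _ ρpos
  have J := (ENNReal.mul_le_mul_iff_left (measure_ball_pos μ (0 : E) zero_lt_one).ne'
    measure_ball_lt_top.ne).1 I
  rw [← ENNReal.ofReal_natCast, ← ENNReal.ofReal_mul (by positivity),
    ENNReal.ofReal_le_ofReal_iff (by positivity)] at J
  have : (1 + 2 / η) ^ finrank ℝ E = (1 + η / 2) ^ finrank ℝ E / (η / 2) ^ finrank ℝ E := by
    rw [← div_pow]
    congr 1
    field_simp
    ring
  rw [this, le_div_iff₀ (by positivity)]
  exact J

open Module in
/-- The unit sphere has an `η`-net of cardinality at most `(1 + 2 / η) ^ dim`. -/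
theorem exists_finset_sphere_net {η : ℝ} (hη : 0 < η) :
    ∃ N : Finset E, (∀ c ∈ N, ‖c‖ = 1) ∧ (N.card : ℝ) ≤ (1 + 2 / η) ^ finrank ℝ E ∧
      ∀ x : E, ‖x‖ = 1 → ∃ c ∈ N, ‖x - c‖ ≤ η := by
  classical
  -- A separated subset of the sphere of maximal cardinality is a net. The volume bound ensures that
  -- the maximum exists.
  let S : Set ℕ := {k | ∃ s : Finset E, s.card = k ∧ (∀ c ∈ s, ‖c‖ = 1) ∧
    ∀ c ∈ s, ∀ d ∈ s, c ≠ d → η ≤ ‖c - d‖}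
  have hS : BddAbove S := by
    refine ⟨⌊(1 + 2 / η) ^ finrank ℝ E⌋₊, ?_⟩
    rintro k ⟨s, rfl, hs, h⟩
    exact Nat.le_floor (card_le_of_separated_of_norm_le_one hη s (fun c hc => (hs c hc).le) h)
  obtain ⟨N, hN, hN1, hN2⟩ := Nat.sSup_mem (s := S) ⟨0, ∅, by simp⟩ hS
  refine ⟨N, hN1, card_le_of_separated_of_norm_le_one hη N (fun c hc => (hN1 c hc).le) hN2,
    fun x hx => ?_⟩
  by_contra! hfar
  have hxN : x ∉ N := fun hxN => by
    have := hfar x hxN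
    simp only [sub_self, norm_zero] at this
    linarith
  have hmem : N.card + 1 ∈ S := by
    refine ⟨insert x N, Finset.card_insert_of_notMem hxN, ?_, ?_⟩
    · intro c hc
      rcases Finset.mem_insert.1 hc with rfl | hc
      exacts [hx, hN1 c hc]
    · intro c hc d hd hcd
      rcases Finset.mem_insert.1 hc with hcx | hcN <;>
        rcases Finset.mem_insert.1 hd with hdx | hdN
      · exact absurd (hcx.trans hdx.symm) hcd
      · exact hcx ▸ (hfar d hdN).le
      · rw [norm_sub_rev]
        exact hdx ▸ (hfar c hcN).le
      · exact hN2 c hcN d hdN hcd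
  have := le_csSup hS hmem
  omega

/-- Two-sided control of a linear map on an `η`-net of the unit sphere gives a lower bound on the
whole space. -/
theorem le_norm_map_of_net {F : Type*} [NormedAddCommGroup F] [NormedSpace ℝ F] (T : E →ₗ[ℝ] F)
    {η a b : ℝ} (hη : 0 < η) (hη1 : η ≤ 1 / 4) (hb : 0 ≤ b) (N : Finset E)
    (hcov : ∀ x : E, ‖x‖ = 1 → ∃ c ∈ N, ‖x - c‖ ≤ η)
    (hlow : ∀ c ∈ N, a ≤ ‖T c‖) (hup : ∀ c ∈ N, ‖T c‖ ≤ b) (x : E) :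
    (a - η * (4 / 3 * b)) * ‖x‖ ≤ ‖T x‖ := by
  let T' : E →L[ℝ] F := LinearMap.toContinuousLinearMap T
  have hT' : ∀ x, T' x = T x := fun _ => rfl
  -- Passing to a nearby net point bounds the operator norm in terms of itself; `η ≤ 1 / 4` then
  -- absorbs that term and gives `4 / 3 * b`.
  have hop : ‖T'‖ ≤ b + η * ‖T'‖ := by
    refine ContinuousLinearMap.opNorm_le_of_unit_norm (by positivity) fun x hx => ?_
    obtain ⟨c, hc, hxc⟩ := hcov x hx
    calc ‖T' x‖ = ‖T' c + T' (x - c)‖ := by rw [← map_add]; congr 2; abel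
      _ ≤ ‖T' c‖ + ‖T' (x - c)‖ := norm_add_le _ _
      _ ≤ b + ‖T'‖ * ‖x - c‖ := add_le_add (hup c hc) (T'.le_opNorm _)
      _ ≤ b + η * ‖T'‖ := by
        rw [mul_comm η]
        gcongr
  have hop' : ‖T'‖ ≤ 4 / 3 * b := by nlinarith [norm_nonneg T']
  have key : ∀ x : E, ‖x‖ = 1 → a - η * (4 / 3 * b) ≤ ‖T x‖ := by
    intro x hx
    obtain ⟨c, hc, hxc⟩ := hcov x hx
    have h1 : ‖T' (x - c)‖ ≤ 4 / 3 * b * η :=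
      (T'.le_opNorm _).trans (mul_le_mul hop' hxc (norm_nonneg _) (by positivity))
    have h2 : ‖T' c‖ ≤ ‖T' x‖ + ‖T' (x - c)‖ := by
      rw [map_sub, norm_sub_rev]
      have := norm_add_le (T' x) (T' c - T' x)
      simpa using this
    rw [hT'] at h2
    rw [hT'] at h2
    linarith [hlow c hc]
  rcases eq_or_ne x 0 with rfl | hx
  · simp
  have hx' : 0 < ‖x‖ := norm_pos_iff.2 hx
  have := key (‖x‖⁻¹ • x) (by rw [norm_smul, norm_inv, norm_norm, inv_mul_cancel₀ hx'.ne'])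
  rw [map_smul, norm_smul, norm_inv, norm_norm, inv_mul_eq_div, le_div_iff₀ hx'] at this
  exact this

end Net

/-! ### Moments and sub-Gaussianity of weighted sums of signs. -/

section Bounded

variable {Ω : Type*} [MeasurableSpace Ω] {μ : Measure Ω}

/-- A continuous function of an almost surely bounded random variable is integrable. -/
theorem integrable_continuous_comp_of_bounded [IsFiniteMeasure μ] {E : Type*}
    [NormedAddCommGroup E] [ProperSpace E] [MeasurableSpace E] [BorelSpace E] {Z : Ω → E}
    (hZ : AEMeasurable Z μ) {B : ℝ} (hB : ∀ᵐ ω ∂μ, ‖Z ω‖ ≤ B) {f : E → ℝ} (hf : Continuous f) :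
    Integrable (fun ω => f (Z ω)) μ := by
  obtain ⟨c, hc⟩ := (isCompact_closedBall (0 : E) B).exists_bound_of_continuousOn hf.continuousOn
  refine Integrable.of_bound (hf.measurable.comp_aemeasurable hZ).aestronglyMeasurable c ?_
  filter_upwards [hB] with ω hω
  exact hc _ (by simpa using hω)

end Bounded

namespace IsSymmetricSign

variable {Ω : Type*} [MeasurableSpace Ω] {μ : Measure Ω} [IsProbabilityMeasure μ] {a : ℝ}
  {X : Ω → ℝ}

theorem ae_eq_or_eq (h : IsSymmetricSign μ a X) (ha : 0 < a) : ∀ᵐ ω ∂μ, X ω = a ∨ X ω = -a := by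
  have hm : ∀ c : ℝ, NullMeasurableSet {ω | X ω = c} μ := fun c =>
    h.aemeasurable.nullMeasurableSet_preimage (measurableSet_singleton c)
  have hd : Disjoint {ω | X ω = a} {ω | X ω = -a} := by
    rw [Set.disjoint_left]
    intro ω h1 h2
    simp only [Set.mem_ofPred_eq] at h1 h2
    linarith
  have hu : μ ({ω | X ω = a} ∪ {ω | X ω = -a}) = 1 := by
    rw [measure_union₀ (hm _) hd.aedisjoint, h.prob_pos, h.prob_neg, ENNReal.add_halves]
  exact (prob_compl_eq_zero_iff₀ ((hm _).union (hm _))).2 hu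

theorem sq_ae_eq (h : IsSymmetricSign μ a X) (ha : 0 < a) : ∀ᵐ ω ∂μ, X ω ^ 2 = a ^ 2 := by
  filter_upwards [h.ae_eq_or_eq ha] with ω hω
  rcases hω with hω | hω <;> rw [hω]
  ring

theorem ae_abs_eq (h : IsSymmetricSign μ a X) (ha : 0 < a) : ∀ᵐ ω ∂μ, |X ω| = a := by
  filter_upwards [h.sq_ae_eq ha] with ω hω
  rw [← abs_of_pos ha]
  exact sq_eq_sq_iff_abs_eq_abs _ _ |>.1 hω

theorem integral_eq_zero (h : IsSymmetricSign μ a X) (ha : 0 < a) : ∫ ω, X ω ∂μ = 0 := by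
  have hm : ∀ c : ℝ, NullMeasurableSet {ω | X ω = c} μ := fun c =>
    h.aemeasurable.nullMeasurableSet_preimage (measurableSet_singleton c)
  have hX : X =ᵐ[μ] fun ω => {ω | X ω = a}.indicator (fun _ => a) ω -
      {ω | X ω = -a}.indicator (fun _ => a) ω := by
    filter_upwards [h.ae_eq_or_eq ha] with ω hω
    have hne : a ≠ -a := by linarith
    rcases hω with hω | hω <;> simp [Set.indicator, hω, hne, hne.symm]
  rw [integral_congr_ae hX, integral_sub ((integrable_const a).indicator₀ (hm _))
    ((integrable_const a).indicator₀ (hm _)), integral_indicator₀ (hm _),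
    integral_indicator₀ (hm _)]
  simp [measureReal_def, h.prob_pos, h.prob_neg]

theorem hasSubgaussianMGF (h : IsSymmetricSign μ a X) (ha : 0 < a) :
    HasSubgaussianMGF X (Real.toNNReal (a ^ 2)) μ := by
  have := hasSubgaussianMGF_of_mem_Icc_of_integral_eq_zero (μ := μ) (X := X) (a := -a) (b := a)
    h.aemeasurable ?_ (h.integral_eq_zero ha)
  · convert this using 1
    ext
    rw [Real.coe_toNNReal _ (sq_nonneg a)]
    push_cast
    rw [Real.norm_eq_abs, abs_of_pos (by linarith)]
    ring
  · filter_upwards [h.ae_abs_eq ha] with ω hω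
    exact abs_le.1 hω.le

end IsSymmetricSign

section SignSums

variable {Ω : Type*} [MeasurableSpace Ω] {μ : Measure Ω} {a : ℝ} {ι : Type*} {X : ι → Ω → ℝ}

theorem aemeasurable_sum_mul_sign (hX : ∀ i, IsSymmetricSign μ a (X i)) (u : ι → ℝ)
    (s : Finset ι) : AEMeasurable (fun ω => ∑ i ∈ s, u i * X i ω) μ :=
  Finset.aemeasurable_fun_sum s fun i _ => (hX i).aemeasurable.const_mul (u i)

variable [IsProbabilityMeasure μ]

theorem abs_sum_mul_sign_le (hX : ∀ i, IsSymmetricSign μ a (X i)) (ha : 0 < a) (u : ι → ℝ)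
    (s : Finset ι) : ∀ᵐ ω ∂μ, |∑ i ∈ s, u i * X i ω| ≤ ∑ i ∈ s, |u i| * a := by
  have : ∀ᵐ ω ∂μ, ∀ i ∈ s, |X i ω| = a :=
    (Finset.eventually_all s).2 fun i _ => (hX i).ae_abs_eq ha
  filter_upwards [this] with ω hω
  refine (Finset.abs_sum_le_sum_abs _ _).trans (Finset.sum_le_sum fun i hi => ?_)
  rw [abs_mul, hω i hi]

theorem hasSubgaussianMGF_sum_mul_sign (hX : ∀ i, IsSymmetricSign μ a (X i)) (ha : 0 < a)
    (hind : iIndepFun X μ) (u : ι → ℝ) (s : Finset ι) :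
    HasSubgaussianMGF (fun ω => ∑ i ∈ s, u i * X i ω)
      (Real.toNNReal (a ^ 2 * ∑ i ∈ s, u i ^ 2)) μ := by
  have h := HasSubgaussianMGF.sum_of_iIndepFun (s := s)
    (hind.comp (fun i x => u i * x) fun i => measurable_const_mul (u i))
    (fun i _ => ((hX i).hasSubgaussianMGF ha).const_mul (u i))
  have hc : Real.toNNReal (a ^ 2 * ∑ i ∈ s, u i ^ 2) =
      ∑ i ∈ s, (⟨u i ^ 2, sq_nonneg _⟩ * Real.toNNReal (a ^ 2) : NNReal) := by
    ext
    rw [Real.coe_toNNReal _ (by positivity), Finset.mul_sum, NNReal.coe_sum]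
    refine Finset.sum_congr rfl fun i _ => ?_
    calc a ^ 2 * u i ^ 2 = u i ^ 2 * (Real.toNNReal (a ^ 2) : ℝ) := by
          rw [Real.coe_toNNReal _ (sq_nonneg a), mul_comm]
      _ = _ := rfl
  rw [hc]
  exact h

/-- Second and fourth moments of a weighted sum of independent symmetric signs. -/
theorem moments_sum_mul_sign (hX : ∀ i, IsSymmetricSign μ a (X i)) (ha : 0 < a)
    (hind : iIndepFun X μ) (u : ι → ℝ) (s : Finset ι) :
    ∫ ω, (∑ i ∈ s, u i * X i ω) ^ 2 ∂μ = a ^ 2 * ∑ i ∈ s, u i ^ 2 ∧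
      ∫ ω, (∑ i ∈ s, u i * X i ω) ^ 4 ∂μ ≤ 3 * (a ^ 2 * ∑ i ∈ s, u i ^ 2) ^ 2 := by
  classical
  induction s using Finset.induction_on with
  | empty => simp
  | insert j s hj ih =>
    set S : Ω → ℝ := fun ω => ∑ i ∈ s, u i * X i ω with hS
    have hSm : AEMeasurable S μ := aemeasurable_sum_mul_sign hX u s
    have hindep : IndepFun S (X j) μ := by
      have h1 := iIndepFun.indepFun_finset₀ s {j} (by simpa using hj) hind
        fun i => (hX i).aemeasurable
      exact h1.comp (φ := fun x : s → ℝ => ∑ i : s, u i * x i)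
        (ψ := fun x : ({j} : Finset ι) → ℝ => x ⟨j, by simp⟩) (by fun_prop) (by fun_prop) |>.congr
        (Filter.Eventually.of_forall fun ω => by
          simp [S, Finset.sum_attach s (fun i => u i * X i ω)])
        (Filter.Eventually.of_forall fun ω => rfl)
    have hbd : ∀ᵐ ω ∂μ, ‖(S ω, X j ω)‖ ≤ max (∑ i ∈ s, |u i| * a) a := by
      filter_upwards [abs_sum_mul_sign_le hX ha u s, (hX j).ae_abs_eq ha] with ω h1 h2
      exact max_le_max h1 h2.le
    have hint : ∀ {f : ℝ × ℝ → ℝ}, Continuous f → Integrable (fun ω => f (S ω, X j ω)) μ :=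
      fun hf => integrable_continuous_comp_of_bounded
        (hSm.prodMk (hX j).aemeasurable) hbd hf
    -- In the expansions below, `X j ^ 2 = a ^ 2` almost surely reduces every term to degree at most
    -- one in `X j`; the terms of degree one then integrate to zero.
    have hzero : ∀ k : ℕ, ∫ ω, S ω ^ k * X j ω ∂μ = 0 := by
      intro k
      have := (hindep.comp (φ := fun x => x ^ k) (ψ := id) (by fun_prop)
        measurable_id).integral_fun_mul_eq_mul_integral
        (hSm.pow_const k).aestronglyMeasurable (hX j).aemeasurable.aestronglyMeasurable
      simp only [Function.comp_apply, id] at this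
      rw [this, (hX j).integral_eq_zero ha, mul_zero]
    have i2 : Integrable (fun ω => S ω ^ 2) μ := hint (f := fun p => p.1 ^ 2) (by fun_prop)
    have i4 : Integrable (fun ω => S ω ^ 4) μ := hint (f := fun p => p.1 ^ 4) (by fun_prop)
    have i1x : Integrable (fun ω => S ω ^ 1 * X j ω) μ :=
      hint (f := fun p => p.1 ^ 1 * p.2) (by fun_prop)
    have i3x : Integrable (fun ω => S ω ^ 3 * X j ω) μ :=
      hint (f := fun p => p.1 ^ 3 * p.2) (by fun_prop)
    have e2 : ∫ ω, (∑ i ∈ insert j s, u i * X i ω) ^ 2 ∂μ =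
        ∫ ω, S ω ^ 2 ∂μ + u j ^ 2 * a ^ 2 := by
      have : (fun ω => (∑ i ∈ insert j s, u i * X i ω) ^ 2) =ᵐ[μ]
          fun ω => (S ω ^ 2 + 2 * u j * (S ω ^ 1 * X j ω)) + u j ^ 2 * a ^ 2 := by
        filter_upwards [(hX j).sq_ae_eq ha] with ω hω
        rw [Finset.sum_insert hj, ← hω]
        ring
      have j1 : Integrable (fun ω => S ω ^ 2 + 2 * u j * (S ω ^ 1 * X j ω)) μ :=
        i2.add (i1x.const_mul _)
      rw [integral_congr_ae this, integral_add j1 (integrable_const _),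
        integral_add i2 (i1x.const_mul _), integral_const_mul, hzero]
      simp
    have e4 : ∫ ω, (∑ i ∈ insert j s, u i * X i ω) ^ 4 ∂μ =
        ∫ ω, S ω ^ 4 ∂μ + 6 * u j ^ 2 * a ^ 2 * ∫ ω, S ω ^ 2 ∂μ + u j ^ 4 * a ^ 4 := by
      have : (fun ω => (∑ i ∈ insert j s, u i * X i ω) ^ 4) =ᵐ[μ]
          fun ω => (((S ω ^ 4 + 6 * u j ^ 2 * a ^ 2 * S ω ^ 2) + 4 * u j * (S ω ^ 3 * X j ω)) +
            4 * u j ^ 3 * a ^ 2 * (S ω ^ 1 * X j ω)) + u j ^ 4 * a ^ 4 := by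
        filter_upwards [(hX j).sq_ae_eq ha] with ω hω
        rw [Finset.sum_insert hj, show a ^ 4 = (a ^ 2) ^ 2 by ring, ← hω]
        ring
      have j1 : Integrable (fun ω => S ω ^ 4 + 6 * u j ^ 2 * a ^ 2 * S ω ^ 2) μ :=
        i4.add (i2.const_mul _)
      have j2 : Integrable (fun ω => S ω ^ 4 + 6 * u j ^ 2 * a ^ 2 * S ω ^ 2 +
          4 * u j * (S ω ^ 3 * X j ω)) μ := j1.add (i3x.const_mul _)
      have j3 : Integrable (fun ω => S ω ^ 4 + 6 * u j ^ 2 * a ^ 2 * S ω ^ 2 +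
          4 * u j * (S ω ^ 3 * X j ω) + 4 * u j ^ 3 * a ^ 2 * (S ω ^ 1 * X j ω)) μ :=
        j2.add (i1x.const_mul _)
      rw [integral_congr_ae this, integral_add j3 (integrable_const _),
        integral_add j2 (i1x.const_mul _), integral_add j1 (i3x.const_mul _),
        integral_add i4 (i2.const_mul _), integral_const_mul, integral_const_mul,
        integral_const_mul, hzero, hzero]
      simp
    obtain ⟨ih2, ih4⟩ := ih
    rw [e2, e4, Finset.sum_insert hj, ih2]
    refine ⟨by ring, ?_⟩
    nlinarith [sq_nonneg (u j ^ 2 * a ^ 2)]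

end SignSums

/-! ### Exponential moments of squares. -/

section GaussianTrick

open Real in
theorem lintegral_exp_mul_gaussianReal (t : ℝ) :
    ∫⁻ g, ENNReal.ofReal (exp (t * g)) ∂(gaussianReal 0 1) = ENNReal.ofReal (exp (t ^ 2 / 2)) := by
  rw [← ofReal_integral_eq_lintegral_ofReal (integrable_exp_mul_gaussianReal t)
    (Filter.Eventually.of_forall fun _ => (exp_pos _).le)]
  have := mgf_gaussianReal (p := gaussianReal 0 1) (X := id) (μ := 0) (v := 1) (by simp) t
  simp only [mgf, id] at this
  rw [this]
  simp

open Real in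
-- The weight changes the exponent of the density from `-g ^ 2 / 2` to `-g ^ 2 / 4`, that is, to
-- variance two without its normalization; the missing factor is `√2`.
theorem lintegral_exp_sq_div_four_gaussianReal :
    ∫⁻ g, ENNReal.ofReal (exp (g ^ 2 / 4)) ∂(gaussianReal 0 1) = ENNReal.ofReal √2 := by
  rw [gaussianReal_of_var_ne_zero _ one_ne_zero,
    lintegral_withDensity_eq_lintegral_mul _ (measurable_gaussianPDF 0 1) (by fun_prop)]
  have h : ∀ g : ℝ, (gaussianPDF 0 1 * fun g => ENNReal.ofReal (exp (g ^ 2 / 4))) g =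
      ENNReal.ofReal ((√(2 * π))⁻¹ * exp (-(1 / 4) * g ^ 2)) := by
    intro g
    rw [Pi.mul_apply, gaussianPDF, ← ENNReal.ofReal_mul (gaussianPDFReal_nonneg _ _ _),
      gaussianPDFReal, mul_assoc, ← exp_add]
    congr 3
    · simp
    · push_cast
      ring_nf
  simp_rw [h]
  rw [← ofReal_integral_eq_lintegral_ofReal
    ((integrable_exp_neg_mul_sq (by norm_num)).const_mul _)
    (Filter.Eventually.of_forall fun _ => by positivity), integral_const_mul, integral_gaussian,
    ← sqrt_inv, ← sqrt_mul (by positivity)]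
  congr 2
  field_simp
  norm_num

open Real in
/-- Exponential square integrability of sub-Gaussian random variables. -/
theorem ProbabilityTheory.HasSubgaussianMGF.lintegral_exp_sq_le {Ω : Type*} [MeasurableSpace Ω]
    {μ : Measure Ω} [IsProbabilityMeasure μ] {X : Ω → ℝ} {c : NNReal} (hX : HasSubgaussianMGF X c μ)
    {h : ℝ} (h0 : 0 ≤ h) (hc : h * c ≤ 1 / 4) :
    ∫⁻ ω, ENNReal.ofReal (exp (h * X ω ^ 2)) ∂μ ≤ ENNReal.ofReal √2 := by
  -- An auxiliary standard Gaussian `g` linearizes the square: `exp (h * X ^ 2)` is the mean of `exp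
  -- (√(2 * h) * X * g)` over `g`. After exchanging the integrals, the sub-Gaussian bound for `X`
  -- leaves `exp (h * c * g ^ 2) ≤ exp (g ^ 2 / 4)`.
  calc ∫⁻ ω, ENNReal.ofReal (exp (h * X ω ^ 2)) ∂μ
      = ∫⁻ ω, ∫⁻ g, ENNReal.ofReal (exp (√(2 * h) * X ω * g)) ∂(gaussianReal 0 1) ∂μ := by
        refine lintegral_congr fun ω => ?_
        rw [lintegral_exp_mul_gaussianReal, mul_pow, sq_sqrt (by positivity)]
        congr 2
        ring
    _ = ∫⁻ g, ∫⁻ ω, ENNReal.ofReal (exp (√(2 * h) * X ω * g)) ∂μ ∂(gaussianReal 0 1) := by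
        refine lintegral_lintegral_swap ?_
        have h1 : AEMeasurable (fun p : Ω × ℝ => X p.1) (μ.prod (gaussianReal 0 1)) :=
          hX.aemeasurable.comp_fst
        have h2 : AEMeasurable (fun p : Ω × ℝ => √(2 * h) * X p.1 * p.2)
          (μ.prod (gaussianReal 0 1)) := (h1.const_mul _).mul measurable_snd.aemeasurable
        exact h2.exp.ennreal_ofReal
    _ ≤ ∫⁻ g, ENNReal.ofReal (exp (g ^ 2 / 4)) ∂(gaussianReal 0 1) := by
        refine lintegral_mono fun g => ?_
        have e : ∀ ω, √(2 * h) * X ω * g = √(2 * h) * g * X ω := fun ω => by ring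
        simp_rw [e]
        rw [← ofReal_integral_eq_lintegral_ofReal (hX.integrable_exp_mul _)
          (Filter.Eventually.of_forall fun _ => (exp_pos _).le)]
        refine ENNReal.ofReal_le_ofReal ((hX.mgf_le _).trans (exp_le_exp.2 ?_))
        rw [mul_pow, sq_sqrt (by positivity)]
        nlinarith [sq_nonneg g]
    _ = ENNReal.ofReal √2 := lintegral_exp_sq_div_four_gaussianReal

end GaussianTrick

/-- Since `(1 - x + x ^ 2 / 2) * (1 + x + x ^ 2 / 2) = 1 + x ^ 4 / 4 ≥ 1`, the quadratic lower bound
for `exp x` can be inverted. -/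
theorem Real.exp_neg_le_one_sub_add {x : ℝ} (hx : 0 ≤ x) :
    Real.exp (-x) ≤ 1 - x + x ^ 2 / 2 := by
  have h1 := Real.quadratic_le_exp_of_nonneg hx
  rw [Real.exp_neg, inv_le_comm₀ (Real.exp_pos x) (by nlinarith [sq_nonneg (x - 1)])]
  refine le_trans ?_ h1
  rw [inv_le_iff_one_le_mul₀' (by nlinarith [sq_nonneg (x - 1)])]
  nlinarith [sq_nonneg (x ^ 2)]

/-! ### Tail bounds for rescaled Rademacher matrices. -/

section Rademacher

variable {Ω : Type*} [MeasurableSpace Ω] {μ : Measure Ω} {n K : ℕ}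
  {V : Ω → Matrix (Fin n) (Fin K) ℝ}

namespace IsRescaledRademacher

theorem column_indep (hV : IsRescaledRademacher μ V) (j : Fin K) :
    iIndepFun (fun (i : Fin n) ω => V ω i j) μ :=
  hV.indep.precomp (g := fun i => (i, j)) fun _ _ h => (Prod.mk.inj h).1

theorem indepFun_columns (hV : IsRescaledRademacher μ V) (u : Fin n → ℝ) {j : Fin K}
    {s : Finset (Fin K)} (hj : j ∉ s) :
    IndepFun (fun ω => (∑ i, u i * V ω i j) ^ 2) (∑ k ∈ s, fun ω => (∑ i, u i * V ω i k) ^ 2) μ := by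
  have hd : Disjoint (Finset.univ ×ˢ {j} : Finset (Fin n × Fin K)) (Finset.univ ×ˢ s) := by
    rw [Finset.disjoint_left]
    rintro ⟨i, k⟩ h1 h2
    simp only [Finset.mem_product, Finset.mem_univ, Finset.mem_singleton, true_and] at h1 h2
    exact hj (h1 ▸ h2)
  have h := iIndepFun.indepFun_finset₀ _ _ hd hV.indep fun p => (hV.sign p.1 p.2).aemeasurable
  have hmj : ∀ i : Fin n, (i, j) ∈ (Finset.univ ×ˢ {j} : Finset (Fin n × Fin K)) := by simp
  have hms : ∀ (i : Fin n) (k : s), (i, k.1) ∈ (Finset.univ ×ˢ s : Finset (Fin n × Fin K)) := by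
    simp
  have h' := h.comp
    (φ := fun x => (∑ i, u i * x ⟨(i, j), hmj i⟩) ^ 2)
    (ψ := fun x => ∑ k : s, (∑ i, u i * x ⟨(i, k.1), hms i k⟩) ^ 2) (by fun_prop) (by fun_prop)
  refine h'.congr (Filter.Eventually.of_forall fun ω => rfl)
    (Filter.Eventually.of_forall fun ω => ?_)
  simp only [Function.comp_apply, Finset.sum_apply]
  exact Finset.sum_attach s fun k => (∑ i, u i * V ω i k) ^ 2

variable [IsProbabilityMeasure μ]

theorem norm_sq_ae_eq (hV : IsRescaledRademacher μ V) (hK : 0 < K) :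
    ∀ᵐ ω ∂μ, ‖V ω‖ ^ 2 = n := by
  have ha : 0 < (√(K : ℝ))⁻¹ := by positivity
  have : ∀ᵐ ω ∂μ, ∀ i j, V ω i j ^ 2 = (√(K : ℝ))⁻¹ ^ 2 :=
    ae_all_iff.2 fun i => ae_all_iff.2 fun j => (hV.sign i j).sq_ae_eq ha
  filter_upwards [this] with ω hω
  have hK' : (K : ℝ) ≠ 0 := by positivity
  rw [Matrix.frobenius_norm_sq]
  simp [hω, hK']

theorem integrable_exp (hV : IsRescaledRademacher μ V) (hK : 0 < K) (u : Fin n → ℝ)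
    (s : Finset (Fin K)) (t : ℝ) :
    Integrable (fun ω => Real.exp (t * (∑ k ∈ s, fun ω => (∑ i, u i * V ω i k) ^ 2) ω)) μ := by
  have ha : 0 < (√(K : ℝ))⁻¹ := by positivity
  have hb : ∀ᵐ ω ∂μ, ‖fun k => ∑ i, u i * V ω i k‖ ≤ ∑ i, |u i| * (√(K : ℝ))⁻¹ := by
    filter_upwards [ae_all_iff.2 fun k =>
      abs_sum_mul_sign_le (fun i => hV.sign i k) ha u Finset.univ] with ω hω
    exact (pi_norm_le_iff_of_nonneg (by positivity)).2 hω
  have hm : AEMeasurable (fun ω (k : Fin K) => ∑ i, u i * V ω i k) μ :=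
    aemeasurable_pi_iff.2 fun k => aemeasurable_sum_mul_sign (fun i => hV.sign i k) u Finset.univ
  have := integrable_continuous_comp_of_bounded hm hb
    (f := fun x => Real.exp (t * ∑ k ∈ s, x k ^ 2)) (by fun_prop)
  simpa using this

theorem mgf_sum_le (hV : IsRescaledRademacher μ V) (hK : 0 < K) (u : Fin n → ℝ) {t b : ℝ}
    (hb : ∀ j, mgf (fun ω => (∑ i, u i * V ω i j) ^ 2) μ t ≤ b) (s : Finset (Fin K)) :
    mgf (∑ k ∈ s, fun ω => (∑ i, u i * V ω i k) ^ 2) μ t ≤ b ^ s.card := by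
  induction s using Finset.induction_on with
  | empty => simp
  | insert j s hj ih =>
    have h1 := hV.integrable_exp hK u {j} t
    rw [Finset.sum_singleton] at h1
    rw [Finset.sum_insert hj, (hV.indepFun_columns u hj).mgf_add
      h1.aestronglyMeasurable (hV.integrable_exp hK u s t).aestronglyMeasurable,
      Finset.card_insert_of_notMem hj, pow_succ, mul_comm]
    exact mul_le_mul ih (hb j) mgf_nonneg (mgf_nonneg.trans ih)

open Real in
/-- Lower tail of the squared norm of the projection of a fixed vector. -/
theorem measure_lower_tail_le (hV : IsRescaledRademacher μ V) (hK : 0 < K) (u : Fin n → ℝ)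
    {ε : ℝ} (hε : 0 < ε) :
    μ.real {ω | ∑ j, (∑ i, u i * V ω i j) ^ 2 < (1 - ε) * ∑ i, u i ^ 2} ≤
      exp (-(K * ε ^ 2 / 6)) := by
  have ha : 0 < (√(K : ℝ))⁻¹ := by positivity
  have hK' : (0 : ℝ) < K := by positivity
  have ha2 : (√(K : ℝ))⁻¹ ^ 2 = (K : ℝ)⁻¹ := by rw [inv_pow, sq_sqrt hK'.le]
  set σ := ∑ i, u i ^ 2 with hσ
  have hσ0 : 0 ≤ σ := by positivity
  rcases hσ0.eq_or_lt with hσ0 | hσ0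
  · have : {ω | ∑ j, (∑ i, u i * V ω i j) ^ 2 < (1 - ε) * σ} = ∅ := by
      ext ω
      simp only [← hσ0, mul_zero, Set.mem_ofPred_eq, Set.mem_empty_iff_false, iff_false, not_lt]
      positivity
    rw [this]
    simp [(exp_pos _).le]
  -- With second moment `σ / K` and fourth moment at most `3 * (σ / K) ^ 2`, this `h` minimizes the
  -- Chernoff exponent `-ε * h * σ + 3 * (h * σ) ^ 2 / (2 * K)`, with minimum `-(K * ε ^ 2 / 6)`.
  let h : ℝ := ε * K / (3 * σ)
  have hpos : 0 < h := by positivity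
  have hmgf : ∀ j, mgf (fun ω => (∑ i, u i * V ω i j) ^ 2) μ (-h) ≤
      exp (-(ε / 3) + ε ^ 2 / 6) := by
    intro j
    obtain ⟨m2, m4⟩ := moments_sum_mul_sign (fun i => hV.sign i j) ha (hV.column_indep j) u
      Finset.univ
    rw [ha2] at m2 m4
    have hb := abs_sum_mul_sign_le (fun i => hV.sign i j) ha u Finset.univ
    have hm := aemeasurable_sum_mul_sign (fun i => hV.sign i j) u Finset.univ
    have hint : ∀ {f : ℝ → ℝ}, Continuous f → Integrable (fun ω => f (∑ i, u i * V ω i j)) μ :=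
      fun hf => integrable_continuous_comp_of_bounded hm hb hf
    have i2 := hint (f := fun x => -h * x ^ 2) (by fun_prop)
    have i4 := hint (f := fun x => h ^ 2 / 2 * x ^ 4) (by fun_prop)
    have i24 : Integrable (fun ω => 1 + -h * (∑ i, u i * V ω i j) ^ 2) μ :=
      (integrable_const _).add i2
    calc mgf (fun ω => (∑ i, u i * V ω i j) ^ 2) μ (-h)
        ≤ ∫ ω, (1 + -h * (∑ i, u i * V ω i j) ^ 2) + h ^ 2 / 2 * (∑ i, u i * V ω i j) ^ 4 ∂μ := by
          refine integral_mono (hint (f := fun x => exp (-h * x ^ 2)) (by fun_prop))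
            (i24.add i4) fun ω => ?_
          have := exp_neg_le_one_sub_add (x := h * (∑ i, u i * V ω i j) ^ 2) (by positivity)
          simp only [neg_mul]
          refine this.trans (le_of_eq ?_)
          ring
      _ = 1 - h * ∫ ω, (∑ i, u i * V ω i j) ^ 2 ∂μ +
            h ^ 2 / 2 * ∫ ω, (∑ i, u i * V ω i j) ^ 4 ∂μ := by
          rw [integral_add i24 i4, integral_add (integrable_const _) i2, integral_const_mul,
            integral_const_mul]
          simp
          ring
      _ ≤ 1 - h * ((K : ℝ)⁻¹ * σ) + h ^ 2 / 2 * (3 * ((K : ℝ)⁻¹ * σ) ^ 2) := by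
          rw [m2]
          gcongr
      _ = -(ε / 3) + ε ^ 2 / 6 + 1 := by
          simp only [h]
          field_simp
          ring
      _ ≤ exp (-(ε / 3) + ε ^ 2 / 6) := add_one_le_exp _
  have hsum := hV.mgf_sum_le hK u hmgf Finset.univ
  have hch := measure_le_le_exp_mul_mgf (μ := μ) ((1 - ε) * σ) (by linarith : -h ≤ 0)
    (hV.integrable_exp hK u Finset.univ (-h))
  rw [Finset.card_univ, Fintype.card_fin, ← exp_nat_mul] at hsum
  calc μ.real {ω | ∑ j, (∑ i, u i * V ω i j) ^ 2 < (1 - ε) * σ}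
      ≤ μ.real {ω | (∑ k, fun ω => (∑ i, u i * V ω i k) ^ 2) ω ≤ (1 - ε) * σ} := by
        refine measureReal_mono fun ω hω => ?_
        simp only [Set.mem_ofPred_eq, Finset.sum_apply] at hω ⊢
        exact hω.le
    _ ≤ _ := hch
    _ ≤ exp (-(-h) * ((1 - ε) * σ)) * exp (K * (-(ε / 3) + ε ^ 2 / 6)) := by gcongr
    _ = exp (-(K * ε ^ 2 / 6)) := by
        rw [← exp_add]
        congr 1
        simp only [h]
        field_simp
        ring

open Real in
/-- Upper tail of the squared norm of the projection of a fixed vector. -/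
theorem measure_upper_tail_le (hV : IsRescaledRademacher μ V) (hK : 0 < K) (u : Fin n → ℝ) :
    μ.real {ω | 9 * ∑ i, u i ^ 2 < ∑ j, (∑ i, u i * V ω i j) ^ 2} ≤ exp (-(K / 6)) := by
  have ha : 0 < (√(K : ℝ))⁻¹ := by positivity
  have hK' : (0 : ℝ) < K := by positivity
  have ha2 : (√(K : ℝ))⁻¹ ^ 2 = (K : ℝ)⁻¹ := by rw [inv_pow, sq_sqrt hK'.le]
  set σ := ∑ i, u i ^ 2 with hσ
  have hσ0 : 0 ≤ σ := by positivity
  rcases hσ0.eq_or_lt with hσ0 | hσ0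
  · have hu : ∀ i, u i = 0 := by
      intro i
      have := (Finset.sum_eq_zero_iff_of_nonneg fun i _ => sq_nonneg (u i)).1
        (hσ.symm.trans hσ0.symm) i (Finset.mem_univ i)
      exact pow_eq_zero_iff two_ne_zero |>.1 this
    have : {ω | 9 * σ < ∑ j, (∑ i, u i * V ω i j) ^ 2} = ∅ := by
      ext ω
      simp [← hσ0, hu]
    rw [this]
    simp [(exp_pos _).le]
  -- The variance proxy of a column sum is `σ / K`, so this is the largest `h` allowed by
  -- `lintegral_exp_sq_le`. The total exponent is `-9 * K / 4 + K`, well below `-(K / 6)`.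
  let h : ℝ := K / (4 * σ)
  have hpos : 0 < h := by positivity
  have hmgf : ∀ j, mgf (fun ω => (∑ i, u i * V ω i j) ^ 2) μ h ≤ exp 1 := by
    intro j
    have hsub := hasSubgaussianMGF_sum_mul_sign (fun i => hV.sign i j) ha (hV.column_indep j) u
      Finset.univ
    have hl := hsub.lintegral_exp_sq_le hpos.le (by
      rw [coe_toNNReal _ (by positivity), ha2, ← hσ]
      simp only [h]
      field_simp
      norm_num)
    have hi := hV.integrable_exp hK u {j} h
    simp only [Finset.sum_singleton] at hi
    rw [← ofReal_integral_eq_lintegral_ofReal hi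
      (Filter.Eventually.of_forall fun _ => (exp_pos _).le),
      ENNReal.ofReal_le_ofReal_iff (by positivity)] at hl
    have h2 : √2 ≤ 2 := by
      rw [sqrt_le_left (by norm_num)]
      norm_num
    exact hl.trans (h2.trans (by linarith [add_one_le_exp (1 : ℝ)]))
  have hsum := hV.mgf_sum_le hK u hmgf Finset.univ
  have hch := measure_ge_le_exp_mul_mgf (μ := μ) (9 * σ) hpos.le
    (hV.integrable_exp hK u Finset.univ h)
  rw [Finset.card_univ, Fintype.card_fin, ← exp_nat_mul] at hsum
  calc μ.real {ω | 9 * σ < ∑ j, (∑ i, u i * V ω i j) ^ 2}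
      ≤ μ.real {ω | 9 * σ ≤ (∑ k, fun ω => (∑ i, u i * V ω i k) ^ 2) ω} := by
        refine measureReal_mono fun ω hω => ?_
        simp only [Set.mem_ofPred_eq, Finset.sum_apply] at hω ⊢
        exact hω.le
    _ ≤ _ := hch
    _ ≤ exp (-h * (9 * σ)) * exp (K * 1) := by gcongr
    _ ≤ exp (-(K / 6)) := by
        rw [← exp_add, exp_le_exp]
        have : -h * (9 * σ) = -(9 / 4) * K := by
          simp only [h]
          field_simp
        rw [this]
        linarith

/-- Tail bound for the Frobenius norm of the product of a fixed matrix with a rescaled Rademacher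
matrix. -/
theorem measure_norm_mul_le (hV : IsRescaledRademacher μ V) (hK : 0 < K)
    (M : Matrix (Fin n) (Fin n) ℝ) {ε : ℝ} (hε : 0 < ε) (hε1 : ε ≤ 1) :
    μ.real {ω | ¬ ((1 - ε) * ‖M‖ ^ 2 ≤ ‖M * V ω‖ ^ 2 ∧ ‖M * V ω‖ ^ 2 ≤ 9 * ‖M‖ ^ 2)} ≤
      2 * n * Real.exp (-(K * ε ^ 2 / 6)) := by
  let L : Fin n → Set Ω := fun l =>
    {ω | ∑ j, (∑ i, M l i * V ω i j) ^ 2 < (1 - ε) * ∑ i, M l i ^ 2}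
  let U : Fin n → Set Ω := fun l =>
    {ω | 9 * ∑ i, M l i ^ 2 < ∑ j, (∑ i, M l i * V ω i j) ^ 2}
  have hsub : {ω | ¬ ((1 - ε) * ‖M‖ ^ 2 ≤ ‖M * V ω‖ ^ 2 ∧ ‖M * V ω‖ ^ 2 ≤ 9 * ‖M‖ ^ 2)} ⊆
      ⋃ l, (L l ∪ U l) := by
    intro ω hω
    by_contra hcon
    simp only [Set.mem_iUnion, Set.mem_union, not_exists, not_or, L, U, Set.mem_ofPred_eq,
      not_lt] at hcon
    refine hω ⟨?_, ?_⟩ <;>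
      simp only [Matrix.frobenius_norm_sq, Matrix.mul_apply, Finset.mul_sum]
    · refine Finset.sum_le_sum fun l _ => ?_
      rw [← Finset.mul_sum]
      exact (hcon l).1
    · refine Finset.sum_le_sum fun l _ => ?_
      rw [← Finset.mul_sum]
      exact (hcon l).2
  have hle : ∀ l, μ.real (L l ∪ U l) ≤ 2 * Real.exp (-(K * ε ^ 2 / 6)) := by
    intro l
    refine (measureReal_union_le _ _).trans ?_
    have h1 := hV.measure_lower_tail_le hK (M l) hε
    have h2 := hV.measure_upper_tail_le hK (M l)
    have h3 : Real.exp (-((K : ℝ) / 6)) ≤ Real.exp (-(K * ε ^ 2 / 6)) := by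
      rw [Real.exp_le_exp, neg_le_neg_iff]
      have : (K : ℝ) * ε ^ 2 ≤ K * 1 :=
        mul_le_mul_of_nonneg_left (pow_le_one₀ hε.le hε1) (Nat.cast_nonneg K)
      linarith
    rw [two_mul]
    exact add_le_add h1 (h2.trans h3)
  calc _ ≤ μ.real (⋃ l, (L l ∪ U l)) := measureReal_mono hsub
    _ ≤ ∑ l, μ.real (L l ∪ U l) := measureReal_iUnion_fintype_le _
    _ ≤ ∑ _l : Fin n, 2 * Real.exp (-(K * ε ^ 2 / 6)) := Finset.sum_le_sum fun l _ => hle l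
    _ = _ := by
      rw [Finset.sum_const, Finset.card_univ, Fintype.card_fin, nsmul_eq_mul]
      ring

end IsRescaledRademacher

end Rademacher

/-! ### Sampling without replacement. -/

section Sampling

/-- Maclaurin's inequality between an elementary symmetric mean and a power of the arithmetic
mean. -/
theorem sum_powersetCard_prod_le {ι : Type*} (x : ι → ℝ) (hx : ∀ i, 0 < x i) (s : Finset ι)
    (K : ℕ) :
    ∑ S ∈ s.powersetCard K, ∏ i ∈ S, x i ≤ s.card.choose K * ((∑ i ∈ s, x i) / s.card) ^ K := by
  classical
  induction s using Finset.induction_on generalizing K with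
  | empty =>
    cases K with
    | zero => simp
    | succ K =>
      rw [Finset.powersetCard_eq_empty.2 (by simp)]
      simp
  | insert j s hj ih =>
    rcases s.eq_empty_or_nonempty with rfl | hs
    · rcases K with _ | _ | K
      · simp
      · simp [Finset.powersetCard_one]
      · rw [Finset.powersetCard_eq_empty.2 (by simp), Finset.sum_empty]
        exact mul_nonneg (Nat.cast_nonneg _) (pow_nonneg (div_nonneg
          (Finset.sum_nonneg fun i _ => (hx i).le) (Nat.cast_nonneg _)) _)
    cases K with
    | zero => simp
    | succ K =>
      have hN : (0 : ℝ) < s.card := by exact_mod_cast hs.card_pos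
      set N : ℝ := (s.card : ℝ) with hNdef
      set m : ℝ := (∑ i ∈ s, x i) / N with hm
      have hmpos : 0 < m := div_pos (Finset.sum_pos (fun i _ => hx i) hs) hN
      have hsum : ∑ i ∈ s, x i = N * m := by rw [hm]; field_simp
      have hsplit : ∑ S ∈ (insert j s).powersetCard (K + 1), ∏ i ∈ S, x i =
          ∑ S ∈ s.powersetCard (K + 1), ∏ i ∈ S, x i +
            x j * ∑ S ∈ s.powersetCard K, ∏ i ∈ S, x i := by
        have hnot : ∀ S ∈ s.powersetCard K, j ∉ S := fun S hS h =>
          hj ((Finset.mem_powersetCard.1 hS).1 h)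
        rw [Finset.powersetCard_succ_insert hj, Finset.sum_union, Finset.sum_image,
          Finset.mul_sum]
        · congr 1
          exact Finset.sum_congr rfl fun S hS => Finset.prod_insert (hnot S hS)
        · intro S hS T hT h
          rw [← Finset.erase_insert (hnot S hS), ← Finset.erase_insert (hnot T hT), h]
        · rw [Finset.disjoint_left]
          intro S hS hS'
          obtain ⟨T, -, rfl⟩ := Finset.mem_image.1 hS'
          exact hj ((Finset.mem_powersetCard.1 hS).1 (Finset.mem_insert_self j T))
      -- Here `d` is the relative deviation of the new term from the mean `m` of the old ones.
      -- Pascal's rule makes the inductive bound affine in `d`, and Bernoulli's inequality compares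
      -- it with the power of the new mean.
      set d : ℝ := x j / m - 1 with hd
      have hxj : x j = m * (1 + d) := by rw [hd]; field_simp; ring
      have hd1 : -1 < d := by
        have := div_pos (hx j) hmpos
        linarith
      have hmean : (∑ i ∈ insert j s, x i) / ((insert j s).card : ℝ) = m * (1 + d / (N + 1)) := by
        rw [Finset.sum_insert hj, Finset.card_insert_of_notMem hj, hsum, hxj]
        push_cast
        rw [← hNdef]
        field_simp
        ring
      have hbern : 1 + ((K + 1 : ℕ) : ℝ) * (d / (N + 1)) ≤ (1 + d / (N + 1)) ^ (K + 1) := by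
        refine one_add_mul_le_pow ?_ _
        rw [le_div_iff₀ (by linarith)]
        linarith
      have hch : (N + 1) * (s.card.choose K : ℝ) =
          ((s.card + 1).choose (K + 1) : ℝ) * ((K + 1 : ℕ) : ℝ) := by
        have := Nat.add_one_mul_choose_eq s.card K
        rw [hNdef]
        exact_mod_cast this
      have hpascal : ((s.card + 1).choose (K + 1) : ℝ) =
          s.card.choose K + s.card.choose (K + 1) := by
        exact_mod_cast Nat.choose_succ_succ s.card K
      rw [hsplit, hmean, Finset.card_insert_of_notMem hj, mul_pow]
      calc ∑ S ∈ s.powersetCard (K + 1), ∏ i ∈ S, x i +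
            x j * ∑ S ∈ s.powersetCard K, ∏ i ∈ S, x i
          ≤ s.card.choose (K + 1) * m ^ (K + 1) + x j * (s.card.choose K * m ^ K) :=
            add_le_add (ih _) (mul_le_mul_of_nonneg_left (ih _) (hx j).le)
        _ = m ^ (K + 1) * (((s.card + 1).choose (K + 1) : ℝ) *
              (1 + ((K + 1 : ℕ) : ℝ) * (d / (N + 1)))) := by
            have h2 : ((s.card + 1).choose (K + 1) : ℝ) *
                (1 + ((K + 1 : ℕ) : ℝ) * (d / (N + 1))) =
                ((s.card + 1).choose (K + 1) : ℝ) + d * s.card.choose K := by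
              rw [mul_add, mul_one, ← mul_assoc, ← hch]
              field_simp
            rw [h2, hpascal, hxj]
            ring
        _ ≤ m ^ (K + 1) * (((s.card + 1).choose (K + 1) : ℝ) * (1 + d / (N + 1)) ^ (K + 1)) := by
            gcongr
        _ = _ := by ring

open Real in
/-- Chernoff bound for sampling without replacement, in counting form. -/
theorem card_filter_powersetCard_le {ι : Type*} [Fintype ι] (a : ι → ℝ) (K : ℕ) {t g c : ℝ}
    (hg : (∑ i, exp (t * a i)) / Fintype.card ι ≤ exp g) :
    ((((Finset.univ : Finset ι).powersetCard K).filter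
      fun S => c ≤ t * ∑ i ∈ S, a i).card : ℝ) ≤
      exp (K * g - c) * (Fintype.card ι).choose K := by
  have h1 : ((((Finset.univ : Finset ι).powersetCard K).filter
      fun S => c ≤ t * ∑ i ∈ S, a i).card : ℝ) * exp c ≤
      ∑ S ∈ (Finset.univ : Finset ι).powersetCard K, ∏ i ∈ S, exp (t * a i) := by
    rw [← nsmul_eq_mul, ← Finset.sum_const]
    refine (Finset.sum_le_sum fun S hS => ?_).trans
      (Finset.sum_le_sum_of_subset_of_nonneg (Finset.filter_subset _ _) fun S _ _ => by positivity)
    rw [← exp_sum, ← Finset.mul_sum]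
    exact exp_le_exp.2 (Finset.mem_filter.1 hS).2
  have h2 := sum_powersetCard_prod_le (fun i => exp (t * a i)) (fun i => exp_pos _) Finset.univ K
  rw [Finset.card_univ] at h2
  have h3 : ((∑ i, exp (t * a i)) / Fintype.card ι) ^ K ≤ exp (K * g) := by
    rw [exp_nat_mul]
    exact pow_le_pow_left₀ (by positivity) hg K
  rw [exp_sub, div_mul_eq_mul_div, le_div_iff₀ (exp_pos _)]
  refine (h1.trans h2).trans ?_
  rw [mul_comm]
  gcongr

open Real in
-- Chernoff's method with parameter `-(ε / (b * σ))`: the inequality `a i ^ 2 ≤ b * σ * a i` makes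
-- the quadratic bound on the exponential linear in `a i`, so that only the mean `σ` enters.
theorem card_filter_powersetCard_lt_le {ι : Type*} [Fintype ι] [Nonempty ι] (a : ι → ℝ) (K : ℕ)
    {σ b ε : ℝ} (hσ : 0 < σ) (hb : 0 < b) (hε : 0 < ε) (ha0 : ∀ i, 0 ≤ a i)
    (hab : ∀ i, a i ≤ b * σ) (hmean : ∑ i, a i = Fintype.card ι * σ) :
    ((((Finset.univ : Finset ι).powersetCard K).filter
      fun S => ∑ i ∈ S, a i < (1 - ε) * (K * σ)).card : ℝ) ≤
      exp (-(K * ε ^ 2 / (2 * b))) * (Fintype.card ι).choose K := by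
  have hN : (0 : ℝ) < Fintype.card ι := by exact_mod_cast Fintype.card_pos
  have ht : 0 < ε / (b * σ) := by positivity
  have hg : (∑ i, exp (-(ε / (b * σ)) * a i)) / Fintype.card ι ≤
      exp (-(ε / b) + ε ^ 2 / (2 * b)) := by
    refine le_trans ?_ (add_one_le_exp _)
    rw [div_le_iff₀ hN]
    have hle : ∀ i, exp (-(ε / (b * σ)) * a i) ≤
        1 + (-(ε / (b * σ)) + (ε / (b * σ)) ^ 2 * (b * σ) / 2) * a i := by
      intro i
      have h1 := exp_neg_le_one_sub_add (mul_nonneg ht.le (ha0 i))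
      have h2 : (ε / (b * σ)) ^ 2 * (a i * a i) ≤ (ε / (b * σ)) ^ 2 * (b * σ * a i) :=
        mul_le_mul_of_nonneg_left (mul_le_mul_of_nonneg_right (hab i) (ha0 i)) (sq_nonneg _)
      rw [← neg_mul] at h1
      nlinarith
    refine (Finset.sum_le_sum fun i _ => hle i).trans (le_of_eq ?_)
    rw [Finset.sum_add_distrib, ← Finset.mul_sum, hmean]
    simp only [Finset.sum_const, Finset.card_univ, nsmul_eq_mul, mul_one]
    field_simp
    ring
  have := card_filter_powersetCard_le a K (c := -(ε / (b * σ)) * ((1 - ε) * (K * σ))) hg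
  have e : K * (-(ε / b) + ε ^ 2 / (2 * b)) - -(ε / (b * σ)) * ((1 - ε) * (K * σ)) =
      -(K * ε ^ 2 / (2 * b)) := by
    field_simp
    ring
  rw [e] at this
  refine le_trans ?_ this
  refine Nat.cast_le.2 (Finset.card_le_card fun S hS => ?_)
  rw [Finset.mem_filter] at hS ⊢
  exact ⟨hS.1, mul_le_mul_of_nonpos_left hS.2.le (by linarith)⟩

open Real in
-- Chernoff's method with parameter `1 / (b * σ)`: the exponents lie in `[0, 1]`, where `exp x ≤ 1 +
-- 2 * x`. The total exponent is `2 * K / b - 9 * K / b`.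
theorem card_filter_lt_powersetCard_le {ι : Type*} [Fintype ι] [Nonempty ι] (a : ι → ℝ) (K : ℕ)
    {σ b : ℝ} (hσ : 0 < σ) (hb : 0 < b) (ha0 : ∀ i, 0 ≤ a i)
    (hab : ∀ i, a i ≤ b * σ) (hmean : ∑ i, a i = Fintype.card ι * σ) :
    ((((Finset.univ : Finset ι).powersetCard K).filter
      fun S => 9 * (K * σ) < ∑ i ∈ S, a i).card : ℝ) ≤
      exp (-(7 * K / b)) * (Fintype.card ι).choose K := by
  have hN : (0 : ℝ) < Fintype.card ι := by exact_mod_cast Fintype.card_pos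
  have hg : (∑ i, exp (1 / (b * σ) * a i)) / Fintype.card ι ≤ exp (2 / b) := by
    refine le_trans ?_ (add_one_le_exp _)
    rw [div_le_iff₀ hN]
    have hle : ∀ i, exp (1 / (b * σ) * a i) ≤ 1 + 2 / (b * σ) * a i := by
      intro i
      have h0 : 0 ≤ 1 / (b * σ) * a i := mul_nonneg (by positivity) (ha0 i)
      have h1 : 1 / (b * σ) * a i ≤ 1 := by
        rw [one_div, inv_mul_le_iff₀ (by positivity), mul_one]
        exact hab i
      have h2 := abs_le.1 (abs_exp_sub_one_sub_id_le (abs_le.2 ⟨by linarith, h1⟩))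
      have h3 : 2 / (b * σ) * a i = 2 * (1 / (b * σ) * a i) := by ring
      rw [h3]
      nlinarith [h2.2]
    refine (Finset.sum_le_sum fun i _ => hle i).trans (le_of_eq ?_)
    rw [Finset.sum_add_distrib, ← Finset.mul_sum, hmean]
    simp only [Finset.sum_const, Finset.card_univ, nsmul_eq_mul, mul_one]
    field_simp
    ring
  have := card_filter_powersetCard_le a K (c := 1 / (b * σ) * (9 * (K * σ))) hg
  have e : K * (2 / b) - 1 / (b * σ) * (9 * (K * σ)) = -(7 * K / b) := by
    field_simp
    ring
  rw [e] at this
  refine le_trans ?_ this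
  refine Nat.cast_le.2 (Finset.card_le_card fun S hS => ?_)
  rw [Finset.mem_filter] at hS ⊢
  exact ⟨hS.1, mul_le_mul_of_nonneg_left hS.2.le (by positivity)⟩

/-- Conditioning on a finitely supported random variable that is independent of a uniformly
distributed random subset. -/
theorem measureReal_le_of_uniform_subset {Ω : Type*} [MeasurableSpace Ω] {μ : Measure Ω}
    [IsProbabilityMeasure μ] {E ι : Type*} [MeasurableSpace E] [MeasurableSingletonClass E]
    [Fintype ι] [DecidableEq ι] [MeasurableSpace ι] [MeasurableSingletonClass ι] {K : ℕ}
    (hK : K ≤ Fintype.card ι) {d : Ω → E} {r : Ω → Fin K → ι} (hd : AEMeasurable d μ)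
    (hr : AEMeasurable r μ)
    (hunif : ∀ S : Finset ι, S.card = K →
      μ {ω | Finset.univ.image (r ω) = S} = 1 / ((Fintype.card ι).choose K : ENNReal))
    (hind : IndepFun d r μ) (F : Finset E) (hF : ∀ᵐ ω ∂μ, d ω ∈ F) (G : E → Finset ι → Prop)
    [∀ e, DecidablePred (G e)] {p : ℝ} (hp : 0 ≤ p)
    (hG : ∀ e ∈ F, ((((Finset.univ : Finset ι).powersetCard K).filter (G e)).card : ℝ) ≤
      p * (Fintype.card ι).choose K) :
    (∀ᵐ ω ∂μ, (Finset.univ.image (r ω)).card = K) ∧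
      μ.real {ω | G (d ω) (Finset.univ.image (r ω))} ≤ p := by
  have hC : (0 : ℝ) < ((Fintype.card ι).choose K : ℝ) := by exact_mod_cast Nat.choose_pos hK
  have hunif' : ∀ S : Finset ι, S.card = K →
      μ.real {ω | Finset.univ.image (r ω) = S} = ((Fintype.card ι).choose K : ℝ)⁻¹ := by
    intro S hS
    rw [measureReal_def, hunif S hS]
    simp
  have hmeas : ∀ S : Finset ι, MeasurableSet {ρ : Fin K → ι | Finset.univ.image ρ = S} :=
    fun S => Set.Finite.measurableSet (Set.toFinite _)
  have hnull : ∀ S : Finset ι, NullMeasurableSet {ω | Finset.univ.image (r ω) = S} μ :=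
    fun S => hr.nullMeasurableSet_preimage (hmeas S)
  -- The prescribed probabilities of the `K`-subsets already sum to one, so almost surely no index
  -- is repeated.
  have hcard : ∀ᵐ ω ∂μ, (Finset.univ.image (r ω)).card = K := by
    have hset : {ω | (Finset.univ.image (r ω)).card = K} =
        ⋃ S ∈ (Finset.univ : Finset ι).powersetCard K, {ω | Finset.univ.image (r ω) = S} := by
      ext ω
      simp [Finset.mem_powersetCard]
    have hone : μ.real {ω | (Finset.univ.image (r ω)).card = K} = 1 := by
      rw [hset, measureReal_biUnion_finset₀]
      · rw [Finset.sum_congr rfl fun S hS => hunif' S (Finset.mem_powersetCard.1 hS).2,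
          Finset.sum_const, Finset.card_powersetCard, Finset.card_univ, nsmul_eq_mul,
          mul_inv_cancel₀ hC.ne']
      · intro S _ T _ hST
        refine Disjoint.aedisjoint (Set.disjoint_left.2 fun ω h1 h2 => hST ?_)
        exact h1.symm.trans h2
      · exact fun S _ => hnull S
    have hnm : NullMeasurableSet {ω | (Finset.univ.image (r ω)).card = K} μ := by
      rw [hset]
      exact Finset.nullMeasurableSet_biUnion _ fun S _ => hnull S
    refine (prob_compl_eq_zero_iff₀ hnm).2 ?_
    rw [measureReal_def] at hone
    rw [← ENNReal.ofReal_toReal (measure_ne_top μ _), hone, ENNReal.ofReal_one]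
  refine ⟨hcard, ?_⟩
  -- Up to a null set the event is a finite union over pairs `(e, S)`; by independence each pair has
  -- probability `μ.real (d ⁻¹' {e})` divided by the number of `K`-subsets.
  have hsub : {ω | G (d ω) (Finset.univ.image (r ω))} ≤ᵐ[μ]
      ⋃ e ∈ F, ⋃ S ∈ ((Finset.univ : Finset ι).powersetCard K).filter (G e),
        (d ⁻¹' {e} ∩ {ω | Finset.univ.image (r ω) = S} : Set Ω) := by
    filter_upwards [hcard, hF] with ω h1 h2 h3
    refine Set.mem_biUnion h2 (Set.mem_biUnion (x := Finset.univ.image (r ω)) ?_ ⟨rfl, rfl⟩)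
    exact Finset.mem_coe.2 (Finset.mem_filter.2
      ⟨Finset.mem_powersetCard.2 ⟨Finset.subset_univ _, h1⟩, h3⟩)
  have hprod : ∀ e, ∀ S : Finset ι, S.card = K →
      μ.real (d ⁻¹' {e} ∩ {ω | Finset.univ.image (r ω) = S}) =
        μ.real (d ⁻¹' {e}) * ((Fintype.card ι).choose K : ℝ)⁻¹ := by
    intro e S hS
    rw [← hunif' S hS, measureReal_def, measureReal_def, measureReal_def, ← ENNReal.toReal_mul]
    congr 1
    exact hind.measure_inter_preimage_eq_mul _ _ (measurableSet_singleton e) (hmeas S)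
  have hsum : ∑ e ∈ F, μ.real (d ⁻¹' {e}) ≤ 1 := by
    rw [← measureReal_biUnion_finset₀]
    · exact measureReal_le_one
    · intro e _ e' _ hee
      refine Disjoint.aedisjoint (Set.disjoint_left.2 fun ω h1 h2 => hee ?_)
      exact (Set.mem_singleton_iff.1 h1).symm.trans h2
    · exact fun e _ => hd.nullMeasurableSet_preimage (measurableSet_singleton e)
  calc μ.real {ω | G (d ω) (Finset.univ.image (r ω))}
      ≤ μ.real (⋃ e ∈ F, ⋃ S ∈ ((Finset.univ : Finset ι).powersetCard K).filter (G e),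
        (d ⁻¹' {e} ∩ {ω | Finset.univ.image (r ω) = S})) :=
        ENNReal.toReal_mono (measure_ne_top μ _) (measure_mono_ae hsub)
    _ ≤ ∑ e ∈ F, ∑ S ∈ ((Finset.univ : Finset ι).powersetCard K).filter (G e),
        μ.real (d ⁻¹' {e} ∩ {ω | Finset.univ.image (r ω) = S}) :=
        (measureReal_biUnion_finset_le _ _).trans
          (Finset.sum_le_sum fun e _ => measureReal_biUnion_finset_le _ _)
    _ ≤ ∑ e ∈ F, μ.real (d ⁻¹' {e}) * p := by
        refine Finset.sum_le_sum fun e he => ?_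
        rw [Finset.sum_congr rfl fun S hS =>
          hprod e S (Finset.mem_powersetCard.1 (Finset.mem_filter.1 hS).1).2, Finset.sum_const,
          nsmul_eq_mul, mul_left_comm]
        refine mul_le_mul_of_nonneg_left ?_ measureReal_nonneg
        rw [← div_eq_mul_inv, div_le_iff₀ hC]
        exact hG e he
    _ ≤ p := by
        rw [← Finset.sum_mul]
        exact mul_le_of_le_one_left hp hsum

end Sampling

open Real in
/-- Two-sided tail bound for the square of a sub-Gaussian random variable. -/
theorem ProbabilityTheory.HasSubgaussianMGF.measure_lt_sq_le {Ω : Type*} [MeasurableSpace Ω]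
    {μ : Measure Ω} [IsProbabilityMeasure μ] {X : Ω → ℝ} {c : NNReal} (hX : HasSubgaussianMGF X c μ)
    {b : ℝ} (hb : 0 ≤ b) : μ.real {ω | b * c < X ω ^ 2} ≤ 2 * exp (-(b / 2)) := by
  rcases eq_or_ne c 0 with rfl | hc
  · have h0 := hX.ae_eq_zero_of_hasSubgaussianMGF_zero
    have : μ {ω | b * (0 : NNReal) < X ω ^ 2} = 0 := by
      refine measure_mono_null (t := {ω | ¬ X ω = (0 : Ω → ℝ) ω}) (fun ω hω h => ?_) h0
      simp only [Set.mem_ofPred_eq] at hω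
      simp only [Pi.zero_apply] at h
      rw [h] at hω
      simp at hω
    rw [measureReal_def, this]
    simp [(exp_pos _).le]
  have hcpos : (0 : ℝ) < c := by positivity
  have key : ∀ Y : Ω → ℝ, HasSubgaussianMGF Y c μ →
      μ.real {ω | √(b * c) ≤ Y ω} ≤ exp (-(b / 2)) := by
    intro Y hY
    refine (hY.measure_ge_le (sqrt_nonneg _)).trans (le_of_eq ?_)
    rw [sq_sqrt (by positivity)]
    congr 1
    field_simp
  calc μ.real {ω | b * c < X ω ^ 2}
      ≤ μ.real ({ω | √(b * c) ≤ X ω} ∪ {ω | √(b * c) ≤ (-X) ω}) := by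
        refine measureReal_mono fun ω hω => ?_
        simp only [Set.mem_ofPred_eq] at hω
        have h := sqrt_le_sqrt hω.le
        rw [sqrt_sq_eq_abs] at h
        exact le_abs.1 h
    _ ≤ exp (-(b / 2)) + exp (-(b / 2)) :=
        (measureReal_union_le _ _).trans (add_le_add (key _ hX) (key _ hX.neg))
    _ = _ := by ring

/-! ### Hadamard matrices and tail bounds for P-SRHT matrices. -/

section PSRHT

theorem hadamardSize_le {n : ℕ} (hn : 1 ≤ n) : hadamardSize n ≤ 2 * n := by
  unfold hadamardSize
  rcases hn.eq_or_lt with rfl | hn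
  · simp
  · have h := Nat.pow_pred_clog_lt_self Nat.one_lt_two hn
    have hpos : 0 < Nat.clog 2 n := Nat.clog_pos Nat.one_lt_two hn
    obtain ⟨k, hk⟩ : ∃ k, Nat.clog 2 n = k + 1 := ⟨_, (Nat.succ_pred_eq_of_pos hpos).symm⟩
    rw [hk] at h ⊢
    rw [pow_succ]
    simp only [Nat.pred_eq_sub_one, Nat.add_sub_cancel] at h
    omega

theorem Matrix.IsHadamard.sq_apply {s : Type*} [Fintype s] [DecidableEq s] {H : Matrix s s ℝ}
    (hH : H.IsHadamard) (i j : s) : H i j ^ 2 = 1 := by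
  have := Unitary.star_mul_self_of_mem (hH.apply_mem i j)
  rwa [star_trivial, ← sq] at this

/-- Columns of a Hadamard matrix are orthogonal, with squared norm equal to its size. -/
theorem Matrix.IsHadamard.sum_sq_sum_mul {s ι : Type*} [Fintype s] [DecidableEq s] [Fintype ι]
    {H : Matrix s s ℝ} (hH : H.IsHadamard) {f : ι → s} (hf : Function.Injective f) (w : ι → ℝ) :
    ∑ k, (∑ i, H k (f i) * w i) ^ 2 = Fintype.card s * ∑ i, w i ^ 2 := by
  classical
  have hcol : ∀ i j, ∑ k, H k (f i) * H k (f j) = if i = j then (Fintype.card s : ℝ) else 0 := by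
    intro i j
    have := congrFun (congrFun hH.conjTranspose_mul (f i)) (f j)
    simpa [Matrix.mul_apply, Matrix.one_apply, hf.eq_iff] using this
  calc ∑ k, (∑ i, H k (f i) * w i) ^ 2
      = ∑ k, ∑ i, ∑ j, w i * w j * (H k (f i) * H k (f j)) := by
        refine Finset.sum_congr rfl fun k _ => ?_
        rw [sq, Finset.sum_mul_sum]
        refine Finset.sum_congr rfl fun i _ => Finset.sum_congr rfl fun j _ => ?_
        ring
    _ = ∑ i, ∑ j, w i * w j * ∑ k, H k (f i) * H k (f j) := by
        rw [Finset.sum_comm]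
        refine Finset.sum_congr rfl fun i _ => ?_
        rw [Finset.sum_comm]
        exact Finset.sum_congr rfl fun j _ => (Finset.mul_sum _ _ _).symm
    _ = _ := by
        simp only [hcol, mul_ite, mul_zero, Finset.sum_ite_eq, Finset.mem_univ, if_true,
          Finset.mul_sum]
        refine Finset.sum_congr rfl fun i _ => ?_
        ring

variable {Ω : Type*} [MeasurableSpace Ω] {μ : Measure Ω} [IsProbabilityMeasure μ] {n K : ℕ}
  {V : Ω → Matrix (Fin n) (Fin K) ℝ}

theorem psrht_apply {s : ℕ} (hs : n ≤ s) (H : Matrix (Fin s) (Fin s) ℝ) (d : Fin s → ℝ)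
    (r : Fin K → Fin s) (i : Fin n) (j : Fin K) :
    (((√(K : ℝ))⁻¹ • (((1 : Matrix (Fin s) (Fin s) ℝ).submatrix r id) * H *
      Matrix.diagonal d).transpose).submatrix (Fin.castLE hs) id) i j =
      (√(K : ℝ))⁻¹ * (H (r j) (Fin.castLE hs i) * d (Fin.castLE hs i)) := by
  rw [Matrix.submatrix_apply, Matrix.smul_apply, Matrix.transpose_apply, Matrix.mul_diagonal,
    smul_eq_mul]
  simp [Matrix.mul_apply, Matrix.one_apply]

theorem IsPSRHT.norm_sq_ae_eq (hV : IsPSRHT μ V) (hK : 0 < K) : ∀ᵐ ω ∂μ, ‖V ω‖ ^ 2 = n := by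
  obtain ⟨H, d, r, hH, hd, -, -, -, -, -, hVeq⟩ := hV
  have hK' : (0 : ℝ) < K := by positivity
  have hd2 : ∀ᵐ ω ∂μ, ∀ i, d ω i ^ 2 = 1 ^ 2 := ae_all_iff.2 fun i => (hd i).sq_ae_eq one_pos
  filter_upwards [hVeq, hd2] with ω h1 h2
  rw [Matrix.frobenius_norm_sq, h1]
  simp only [psrht_apply, mul_pow, hH.sq_apply, h2, inv_pow, Real.sq_sqrt hK'.le]
  simp [hK'.ne']

open Real in
/-- Tail bound for the Frobenius norm of the product of a fixed matrix with a P-SRHT matrix. -/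
theorem IsPSRHT.measure_norm_mul_le (hV : IsPSRHT μ V) (hn : 1 ≤ n) (hK : 0 < K)
    (M : Matrix (Fin n) (Fin n) ℝ) {ε b : ℝ} (hε : 0 < ε) (hε1 : ε ≤ 1) (hb : 0 < b) :
    μ.real {ω | ¬ ((1 - ε) * ‖M‖ ^ 2 ≤ ‖M * V ω‖ ^ 2 ∧ ‖M * V ω‖ ^ 2 ≤ 9 * ‖M‖ ^ 2)} ≤
      4 * n ^ 2 * exp (-(b / 2)) + 2 * exp (-(K * ε ^ 2 / (2 * b))) := by
  classical
  obtain ⟨H, d, r, hH, hd, hdind, hr, hKs, hunif, hind, hVeq⟩ := hV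
  have hK' : (0 : ℝ) < K := by positivity
  have hsn : (hadamardSize n : ℝ) ≤ 2 * n := by exact_mod_cast hadamardSize_le hn
  have hns := le_hadamardSize n
  have hspos : 0 < hadamardSize n := by omega
  have : Nonempty (Fin (hadamardSize n)) := ⟨⟨0, hspos⟩⟩
  set σ := ‖M‖ ^ 2 with hσ
  have hσ0 : 0 ≤ σ := sq_nonneg _
  rcases hσ0.eq_or_lt with hσ0 | hσ0
  · have hM : M = 0 := by
      rw [← norm_eq_zero]
      exact pow_eq_zero_iff two_ne_zero |>.1 hσ0.symm
    have : {ω | ¬ ((1 - ε) * σ ≤ ‖M * V ω‖ ^ 2 ∧ ‖M * V ω‖ ^ 2 ≤ 9 * σ)} = ∅ := by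
      ext ω
      simp [← hσ0, hM]
    rw [this, measureReal_empty]
    positivity
  let y : (Fin (hadamardSize n) → ℝ) → Fin n → Fin (hadamardSize n) → ℝ := fun δ l k =>
    ∑ i, M l i * H k (Fin.castLE hns i) * δ (Fin.castLE hns i)
  -- `a δ k` is the contribution of row `k` of `H` to the squared norm, before rescaling by `K`.
  -- Orthogonality of the columns of `H` makes its mean over `k` equal to `σ` for every sign
  -- pattern.
  let a : (Fin (hadamardSize n) → ℝ) → Fin (hadamardSize n) → ℝ := fun δ k => ∑ l, y δ l k ^ 2
  have ha0 : ∀ δ k, 0 ≤ a δ k := fun δ k => Finset.sum_nonneg fun l _ => sq_nonneg _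
  let F : Finset (Fin (hadamardSize n) → ℝ) := Fintype.piFinset fun _ => {1, -1}
  have hdF : ∀ᵐ ω ∂μ, d ω ∈ F := by
    filter_upwards [ae_all_iff.2 fun i => (hd i).ae_eq_or_eq one_pos] with ω hω
    exact Fintype.mem_piFinset.2 fun i => by simpa using hω i
  have hmean : ∀ δ ∈ F, ∑ k, a δ k = Fintype.card (Fin (hadamardSize n)) * σ := by
    intro δ hδ
    have hδ2 : ∀ i, δ i ^ 2 = 1 := by
      intro i
      have := Fintype.mem_piFinset.1 hδ i
      simp only [Finset.mem_insert, Finset.mem_singleton] at this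
      rcases this with h | h <;> rw [h] <;> norm_num
    rw [Finset.sum_comm, hσ, Matrix.frobenius_norm_sq, Finset.mul_sum]
    refine Finset.sum_congr rfl fun l _ => ?_
    have := hH.sum_sq_sum_mul (Fin.castLE_injective hns)
      fun i => M l i * δ (Fin.castLE hns i)
    simp only [mul_pow, hδ2, mul_one] at this
    rw [← this]
    refine Finset.sum_congr rfl fun k _ => ?_
    congr 1
    refine Finset.sum_congr rfl fun i _ => ?_
    ring
  -- Flatness is part of `G`, so sign patterns that are not flat contribute no subsets; their
  -- probability is bounded separately by `hhoeff`.
  let G : (Fin (hadamardSize n) → ℝ) → Finset (Fin (hadamardSize n)) → Prop := fun δ S =>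
    (∀ k, a δ k ≤ b * σ) ∧
      (∑ k ∈ S, a δ k < (1 - ε) * (K * σ) ∨ 9 * (K * σ) < ∑ k ∈ S, a δ k)
  have hG : ∀ δ ∈ F, ((((Finset.univ : Finset (Fin (hadamardSize n))).powersetCard K).filter (G δ)).card : ℝ) ≤
      (2 * exp (-(K * ε ^ 2 / (2 * b)))) * (Fintype.card (Fin (hadamardSize n))).choose K := by
    intro δ hδ
    by_cases hbd : ∀ k, a δ k ≤ b * σ
    · have h1 := card_filter_powersetCard_lt_le (a δ) K hσ0 hb hε (ha0 δ) hbd (hmean δ hδ)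
      have h2 := card_filter_lt_powersetCard_le (a δ) K hσ0 hb (ha0 δ) hbd (hmean δ hδ)
      have h3 : exp (-(7 * K / b)) ≤ exp (-(K * ε ^ 2 / (2 * b))) := by
        rw [exp_le_exp, neg_le_neg_iff, div_le_div_iff₀ (by positivity) hb]
        have : (K : ℝ) * ε ^ 2 ≤ K * 1 :=
          mul_le_mul_of_nonneg_left (pow_le_one₀ hε.le hε1) hK'.le
        nlinarith
      have h4 : (((Finset.univ : Finset (Fin (hadamardSize n))).powersetCard K).filter (G δ)).card ≤
          (((Finset.univ : Finset (Fin (hadamardSize n))).powersetCard K).filter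
            fun S => ∑ k ∈ S, a δ k < (1 - ε) * (K * σ)).card +
          (((Finset.univ : Finset (Fin (hadamardSize n))).powersetCard K).filter
            fun S => 9 * (K * σ) < ∑ k ∈ S, a δ k).card := by
        refine le_trans (Finset.card_le_card fun S hS => ?_) (Finset.card_union_le _ _)
        rw [Finset.mem_filter] at hS
        rw [Finset.mem_union, Finset.mem_filter, Finset.mem_filter]
        exact hS.2.2.imp (fun h => ⟨hS.1, h⟩) fun h => ⟨hS.1, h⟩
      have h5 : ((((Finset.univ : Finset (Fin (hadamardSize n))).powersetCard K).filter (G δ)).card : ℝ) ≤ _ :=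
        Nat.cast_le.2 h4
      push_cast at h5
      have h6 := mul_le_mul_of_nonneg_right h3
        (Nat.cast_nonneg (α := ℝ) ((Fintype.card (Fin (hadamardSize n))).choose K))
      linarith
    · have : ((Finset.univ : Finset (Fin (hadamardSize n))).powersetCard K).filter (G δ) = ∅ :=
        Finset.filter_eq_empty_iff.2 fun S _ h => hbd h.1
      rw [this, Finset.card_empty, Nat.cast_zero]
      positivity
  obtain ⟨hcard, hprob⟩ := measureReal_le_of_uniform_subset (μ := μ) (by simpa using hKs)
    (aemeasurable_pi_iff.2 fun i => (hd i).aemeasurable) hr (by simpa using hunif) hind F hdF G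
    (by positivity) hG
  -- The entries of `H` square to one, so the variance proxy of `y (d ω) l k` is the squared norm of
  -- row `l` of `M`, whatever `k` is.
  have hhoeff : ∀ l k, μ.real {ω | b * ∑ i, M l i ^ 2 < y (d ω) l k ^ 2} ≤
      2 * exp (-(b / 2)) := by
    intro l k
    have hsub := hasSubgaussianMGF_sum_mul_sign
      (fun i : Fin n => hd (Fin.castLE hns i)) one_pos
      (hdind.precomp (Fin.castLE_injective hns))
      (fun i => M l i * H k (Fin.castLE hns i)) Finset.univ
    have := hsub.measure_lt_sq_le hb.le
    rw [coe_toNNReal _ (by positivity)] at this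
    simpa only [mul_pow, hH.sq_apply, mul_one, one_pow, one_mul] using this
  have hsub : {ω | ¬ ((1 - ε) * σ ≤ ‖M * V ω‖ ^ 2 ∧ ‖M * V ω‖ ^ 2 ≤ 9 * σ)} ≤ᵐ[μ]
      ((⋃ l, ⋃ k, {ω | b * ∑ i, M l i ^ 2 < y (d ω) l k ^ 2}) ∪
        {ω | G (d ω) (Finset.univ.image (r ω))} : Set Ω) := by
    filter_upwards [hcard, hVeq] with ω h1 h2 h3
    by_contra hcon
    obtain ⟨hc1, hc2⟩ := not_or.1 hcon
    simp only [Set.mem_iUnion, Set.mem_ofPred_eq, not_exists, not_lt] at hc1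
    have hinj : Function.Injective (r ω) := by
      have := Finset.card_image_iff.1 (h1.trans (Finset.card_fin K).symm)
      rwa [Finset.coe_univ, Set.injOn_univ] at this
    have hbd : ∀ k, a (d ω) k ≤ b * σ := by
      intro k
      rw [hσ, Matrix.frobenius_norm_sq, Finset.mul_sum]
      exact Finset.sum_le_sum fun l _ => hc1 l k
    -- Injectivity of `r ω` turns the sum over the `K` samples into a sum over their image.
    have hnorm : K * ‖M * V ω‖ ^ 2 = ∑ k ∈ Finset.univ.image (r ω), a (d ω) k := by
      rw [Finset.sum_image hinj.injOn, Matrix.frobenius_norm_sq, Finset.sum_comm, Finset.mul_sum]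
      refine Finset.sum_congr rfl fun j _ => ?_
      rw [Finset.mul_sum]
      refine Finset.sum_congr rfl fun l _ => ?_
      have hsum : (M * V ω) l j = (√(K : ℝ))⁻¹ * y (d ω) l (r ω j) := by
        rw [Matrix.mul_apply, h2, Finset.mul_sum]
        refine Finset.sum_congr rfl fun i _ => ?_
        rw [psrht_apply]
        ring
      rw [hsum, mul_pow, inv_pow, sq_sqrt hK'.le, ← mul_assoc, mul_inv_cancel₀ hK'.ne', one_mul]
    refine hc2 ⟨hbd, ?_⟩
    rw [← hnorm]
    by_contra hcc
    rw [not_or, not_lt, not_lt] at hcc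
    refine h3 ⟨?_, ?_⟩
    · refine le_of_mul_le_mul_left ?_ hK'
      linarith [hcc.1]
    · refine le_of_mul_le_mul_left ?_ hK'
      linarith [hcc.2]
  calc _ ≤ μ.real ((⋃ l, ⋃ k, {ω | b * ∑ i, M l i ^ 2 < y (d ω) l k ^ 2}) ∪
        {ω | G (d ω) (Finset.univ.image (r ω))}) :=
        ENNReal.toReal_mono (measure_ne_top μ _) (measure_mono_ae hsub)
    _ ≤ μ.real (⋃ l, ⋃ k, {ω | b * ∑ i, M l i ^ 2 < y (d ω) l k ^ 2}) +
        μ.real {ω | G (d ω) (Finset.univ.image (r ω))} := measureReal_union_le _ _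
    _ ≤ ∑ _l : Fin n, ∑ _k : Fin (hadamardSize n), 2 * exp (-(b / 2)) + 2 * exp (-(K * ε ^ 2 / (2 * b))) := by
        refine add_le_add ((measureReal_iUnion_fintype_le _).trans
          (Finset.sum_le_sum fun l _ => (measureReal_iUnion_fintype_le _).trans
            (Finset.sum_le_sum fun k _ => hhoeff l k))) hprob
    _ ≤ _ := by
        refine add_le_add ?_ le_rfl
        simp only [Finset.sum_const, Finset.card_univ, Fintype.card_fin, nsmul_eq_mul]
        have h1 : (hadamardSize n : ℝ) * (2 * exp (-(b / 2))) ≤ 2 * n * (2 * exp (-(b / 2))) :=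
          mul_le_mul_of_nonneg_right hsn (by positivity)
        have h2 := mul_le_mul_of_nonneg_left h1 (Nat.cast_nonneg (α := ℝ) n)
        linarith

end PSRHT

/-! ### From fixed matrices to the preconditioner. -/

section Assembly

/-- Since `ε' = ε + 2 * ε / (C - 1)`, one has `(√(1 - ε) - ε / C) ^ 2 ≥ 1 - ε - 2 * ε / C ≥ 1 - ε'`.
The right side is nonnegative because `ε' < 1` forces `ε / C ≤ 1 - ε`. -/
theorem sqrt_one_sub_le {ε C ε' : ℝ} (hε : 0 < ε) (hC : 1 < C)
    (hε' : ε' = ε * (C + 1) / (C - 1)) (hε'1 : ε' < 1) :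
    √(1 - ε') ≤ √(1 - ε) - ε / C := by
  have hC1 : 0 < C - 1 := by linarith
  have hC0 : 0 < C := by linarith
  have e : ε' = ε + 2 * (ε / (C - 1)) := by
    rw [hε']
    field_simp
    ring
  have h1 : ε / C ≤ ε / (C - 1) := div_le_div_of_nonneg_left hε.le hC1 (by linarith)
  have h0 : 0 < ε / C := by positivity
  have h2 : ε / C ≤ 1 := (div_le_one hC0).2 (by linarith)
  have hs1 : √(1 - ε) ≤ 1 := Real.sqrt_le_one.2 (by linarith)
  have hs0 := Real.sqrt_nonneg (1 - ε)
  have hsq := Real.sq_sqrt (show 0 ≤ 1 - ε by linarith)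
  have h3 : ε / C ≤ √(1 - ε) := Real.le_sqrt_of_sq_le (by nlinarith)
  refine Real.sqrt_le_iff.2 ⟨by linarith, ?_⟩
  nlinarith

variable {Ω : Type*} [MeasurableSpace Ω] {μ : Measure Ω} [IsProbabilityMeasure μ] {n m K : ℕ}

/-- A tail bound for fixed matrices yields, by means of a net, the bounds on the preconditioner. -/
theorem measure_bounds_of_tail {Ξ : Type*} (hn : 1 ≤ n)
    (A : Ξ → Matrix (Fin n) (Fin n) ℝ) (pts : Fin m → Ξ) (ξ : Ξ)
    {ε δ C ε' : ℝ} (hε : 0 < ε) (hε1 : ε ≤ 1) (hδ : 0 < δ) (hC : 1 < C)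
    (hε' : ε' = ε * (C + 1) / (C - 1)) (hε'1 : ε' < 1)
    (V : Ω → Matrix (Fin n) (Fin K) ℝ) (hVn : ∀ᵐ ω ∂μ, ‖V ω‖ ^ 2 = n)
    (htail : ∀ M : Matrix (Fin n) (Fin n) ℝ,
      μ.real {ω | ¬ ((1 - ε) * ‖M‖ ^ 2 ≤ ‖M * V ω‖ ^ 2 ∧ ‖M * V ω‖ ^ 2 ≤ 9 * ‖M‖ ^ 2)} ≤
        δ / (9 * C / ε) ^ (m + 1)) :
    1 - δ ≤ μ.real {ω | ∀ P : Matrix (Fin n) (Fin n) ℝ,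
      IsSemiNormProjection (inverseSpan A pts) (A ξ) (V ω) P →
        (1 - lowestSingularValue (P * A ξ)) ^ 2 * (1 - ε') ≤ ‖(1 - P * A ξ) * V ω‖ ^ 2 ∧
        ‖(1 - P * A ξ) * V ω‖ ^ 2 ≤ n * (1 - (1 - ε') * lowestSingularValue (P * A ξ) ^ 2) ∧
        conditionNumber (P * A ξ) ≤
          (ENNReal.ofReal (lowestSingularValue (P * A ξ)))⁻¹ *
            ENNReal.ofReal
              √(n * (1 - ε')⁻¹ - (n - 1) * lowestSingularValue (P * A ξ) ^ 2)} := by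
  set good : Set Ω := {ω | ∀ P : Matrix (Fin n) (Fin n) ℝ,
      IsSemiNormProjection (inverseSpan A pts) (A ξ) (V ω) P → _}
  have hC0 : 0 < C := by linarith
  -- The extra index `none` adds the identity, so that `W` contains `1 - P * A ξ` as well as `P * A
  -- ξ`; it accounts for the exponent `m + 1`.
  let gen : Option (Fin m) → Matrix (Fin n) (Fin n) ℝ := fun o =>
    o.elim 1 fun i => (A (pts i))⁻¹ * A ξ
  let W : Submodule ℝ (Matrix (Fin n) (Fin n) ℝ) := Submodule.span ℝ (Set.range gen)
  have hdim : Module.finrank ℝ W ≤ m + 1 := by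
    have := finrank_range_le_card (R := ℝ) gen
    simpa [Set.finrank] using this
  have h1W : (1 : Matrix (Fin n) (Fin n) ℝ) ∈ W := Submodule.subset_span ⟨none, rfl⟩
  have hPW : ∀ P ∈ inverseSpan A pts, P * A ξ ∈ W := by
    have : inverseSpan A pts ≤ W.comap (LinearMap.mulRight ℝ (A ξ)) := by
      refine Submodule.span_le.2 ?_
      rintro _ ⟨i, rfl⟩
      exact Submodule.subset_span ⟨some i, rfl⟩
    exact fun P hP => this hP
  -- With norms at most `3 = √9` on the net, the loss `η * (4 / 3 * 3)` is `ε / C` for this mesh, as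
  -- needed in `sqrt_one_sub_le`.
  have hη : 0 < ε / (4 * C) := by positivity
  have hη1 : ε / (4 * C) ≤ 1 / 4 := by
    rw [div_le_div_iff₀ (by positivity) (by norm_num)]
    linarith
  obtain ⟨N, hN1, hNcard, hNcov⟩ := exists_finset_sphere_net (E := W) hη
  have hLge : 1 ≤ 9 * C / ε := by
    rw [le_div_iff₀ hε]
    linarith
  have hcard : (N.card : ℝ) ≤ (9 * C / ε) ^ (m + 1) := by
    have hbase : 1 + 2 / (ε / (4 * C)) ≤ 9 * C / ε := by
      have : 1 + 2 / (ε / (4 * C)) = (ε + 8 * C) / ε := by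
        field_simp
        ring
      rw [this]
      exact div_le_div_of_nonneg_right (by linarith) hε.le
    calc (N.card : ℝ) ≤ (1 + 2 / (ε / (4 * C))) ^ Module.finrank ℝ W := hNcard
      _ ≤ (9 * C / ε) ^ Module.finrank ℝ W := pow_le_pow_left₀ (by positivity) hbase _
      _ ≤ (9 * C / ε) ^ (m + 1) := pow_le_pow_right₀ hLge hdim
  let bad : W → Set Ω := fun c => {ω | ¬ ((1 - ε) * ‖(c : Matrix (Fin n) (Fin n) ℝ)‖ ^ 2 ≤
    ‖(c : Matrix (Fin n) (Fin n) ℝ) * V ω‖ ^ 2 ∧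
      ‖(c : Matrix (Fin n) (Fin n) ℝ) * V ω‖ ^ 2 ≤ 9 * ‖(c : Matrix (Fin n) (Fin n) ℝ)‖ ^ 2)}
  have hcompl : goodᶜ ≤ᵐ[μ] (⋃ c ∈ N, bad c : Set Ω) := by
    filter_upwards [hVn] with ω hω hng
    by_contra hnot
    have hcon : ∀ c ∈ N, _ := fun c hc => not_not.1 fun h => hnot (Set.mem_biUnion hc h)
    let T : W →ₗ[ℝ] Matrix (Fin n) (Fin K) ℝ :=
      { toFun := fun x => (x : Matrix (Fin n) (Fin n) ℝ) * V ω
        map_add' := fun x y => Matrix.add_mul _ _ _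
        map_smul' := fun t x => Matrix.smul_mul _ _ _ }
    have hlow : ∀ x : W, (1 - ε') * ‖(x : Matrix (Fin n) (Fin n) ℝ)‖ ^ 2 ≤
        ‖(x : Matrix (Fin n) (Fin n) ℝ) * V ω‖ ^ 2 := by
      intro x
      have hnet := le_norm_map_of_net T hη hη1 (a := √(1 - ε)) (b := 3) (by norm_num) N hNcov
        (fun c hc => by
          have h := (hcon c hc).1
          have hc1 : ‖(c : Matrix (Fin n) (Fin n) ℝ)‖ = 1 := hN1 c hc
          rw [hc1, one_pow, mul_one] at h
          exact Real.sqrt_le_iff.2 ⟨norm_nonneg _, h⟩)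
        (fun c hc => by
          have h := (hcon c hc).2
          have hc1 : ‖(c : Matrix (Fin n) (Fin n) ℝ)‖ = 1 := hN1 c hc
          rw [hc1] at h
          refine le_of_sq_le_sq ?_ (by norm_num)
          calc ‖T c‖ ^ 2 ≤ 9 * 1 ^ 2 := h
            _ = 3 ^ 2 := by norm_num) x
      have hη4 : ε / (4 * C) * (4 / 3 * 3) = ε / C := by
        field_simp
      rw [hη4] at hnet
      have h2 := (mul_le_mul_of_nonneg_right (sqrt_one_sub_le hε hC hε' hε'1)
        (norm_nonneg x)).trans hnet
      have h3 := pow_le_pow_left₀ (by positivity) h2 2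
      rw [mul_pow, Real.sq_sqrt (by linarith)] at h3
      exact h3
    refine hng fun P hP => ?_
    have hPB := hPW P hP.1
    exact hP.bounds hn hε'1 hω (hlow ⟨_, W.sub_mem h1W hPB⟩) (hlow ⟨_, hPB⟩)
  have hL : 0 < (9 * C / ε) ^ (m + 1) := by positivity
  have hbad : μ.real goodᶜ ≤ δ := by
    calc μ.real goodᶜ ≤ μ.real (⋃ c ∈ N, bad c) :=
          ENNReal.toReal_mono (measure_ne_top μ _) (measure_mono_ae hcompl)
      _ ≤ ∑ c ∈ N, μ.real (bad c) := measureReal_biUnion_finset_le _ _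
      _ ≤ ∑ _c ∈ N, δ / (9 * C / ε) ^ (m + 1) := Finset.sum_le_sum fun c _ => htail c
      _ = N.card * (δ / (9 * C / ε) ^ (m + 1)) := by rw [Finset.sum_const, nsmul_eq_mul]
      _ ≤ (9 * C / ε) ^ (m + 1) * (δ / (9 * C / ε) ^ (m + 1)) := by gcongr
      _ = δ := mul_div_cancel₀ δ hL.ne'
  -- Subadditivity of the outer measure avoids any measurability claim about `good`.
  have hunion : (1 : ℝ) ≤ μ.real good + μ.real goodᶜ := by
    have := measureReal_union_le (μ := μ) good goodᶜ
    rwa [Set.union_compl_self, probReal_univ] at this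
  linarith

end Assembly

theorem Real.exp_neg_le_of_log_inv_le {x y : ℝ} (hx : 0 < x) (h : Real.log x⁻¹ ≤ y) :
    Real.exp (-y) ≤ x := by
  rw [Real.log_inv] at h
  rw [← Real.le_log_iff_exp_le hx]
  linarith

theorem mainTheorem4 {Ω : Type*} [MeasurableSpace Ω] (μ : Measure Ω) [IsProbabilityMeasure μ]
    {Ξ : Type*} {n m K : ℕ} (hn : 1 ≤ n)
    (A : Ξ → Matrix (Fin n) (Fin n) ℝ) (pts : Fin m → Ξ) (hA : ∀ i, IsUnit (A (pts i))) (ξ : Ξ)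
    (ε δ C ε' : ℝ) (hε : 0 < ε) (hε1 : ε ≤ 1) (hδ : 0 < δ) (hC : 1 < C)
    (hε' : ε' = ε * (C + 1) / (C - 1)) (hε'1 : ε' < 1)
    (V : Ω → Matrix (Fin n) (Fin K) ℝ)
    (hV : (IsRescaledRademacher μ V ∧
          6 / ε ^ 2 * Real.log (2 * n * (9 * C / ε) ^ (m + 1) / δ) ≤ (K : ℝ)) ∨
        (IsPSRHT μ V ∧
          2 / (ε ^ 2 - ε ^ 3 / 3) * Real.log (4 * (9 * C / ε) ^ (m + 1) / δ) *
            (1 + √(8 * Real.log (4 * n * (9 * C / ε) ^ (m + 1) / δ))) ^ 2 ≤ (K : ℝ))) :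
    1 - δ ≤ μ.real {ω | ∀ P : Matrix (Fin n) (Fin n) ℝ,
      IsSemiNormProjection (inverseSpan A pts) (A ξ) (V ω) P →
        (1 - lowestSingularValue (P * A ξ)) ^ 2 * (1 - ε') ≤ ‖(1 - P * A ξ) * V ω‖ ^ 2 ∧
        ‖(1 - P * A ξ) * V ω‖ ^ 2 ≤ n * (1 - (1 - ε') * lowestSingularValue (P * A ξ) ^ 2) ∧
        conditionNumber (P * A ξ) ≤
          (ENNReal.ofReal (lowestSingularValue (P * A ξ)))⁻¹ *
            ENNReal.ofReal
              √(n * (1 - ε')⁻¹ - (n - 1) * lowestSingularValue (P * A ξ) ^ 2)} := by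
  -- For `δ < 1` the logarithms are positive, which forces `0 < K`.
  rcases le_or_gt 1 δ with hδ1 | hδ1
  · exact le_trans (by linarith) measureReal_nonneg
  have hC0 : 0 < C := by linarith
  have hnR : (1 : ℝ) ≤ n := by exact_mod_cast hn
  have hL1 : 1 ≤ (9 * C / ε) ^ (m + 1) := by
    refine one_le_pow₀ ?_
    rw [le_div_iff₀ hε]
    linarith
  have hA' := measure_bounds_of_tail (μ := μ) hn A pts ξ hε hε1 hδ hC hε' hε'1 V
  set L : ℝ := (9 * C / ε) ^ (m + 1)
  have hL : 0 < L := by linarith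
  rcases hV with ⟨hV, hK⟩ | ⟨hV, hK⟩
  · have hpos : 0 < Real.log (2 * n * L / δ) := by
      refine Real.log_pos ?_
      rw [lt_div_iff₀ hδ]
      nlinarith
    have hK0 : 0 < K := by
      have : (0 : ℝ) < K := lt_of_lt_of_le (by positivity) hK
      exact_mod_cast this
    refine hA' (hV.norm_sq_ae_eq hK0) fun M => ?_
    refine (hV.measure_norm_mul_le hK0 M hε hε1).trans ?_
    have hexp : Real.exp (-(K * ε ^ 2 / 6)) ≤ δ / (2 * n * L) := by
      refine Real.exp_neg_le_of_log_inv_le (by positivity) ?_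
      rw [inv_div, le_div_iff₀ (by norm_num), ← div_le_iff₀ (by positivity)]
      refine le_trans (le_of_eq ?_) hK
      ring
    calc 2 * n * Real.exp (-(K * ε ^ 2 / 6)) ≤ 2 * n * (δ / (2 * n * L)) := by gcongr
      _ = δ / L := by
        field_simp
  · have hlog1 : 0 < Real.log (4 * L / δ) := by
      refine Real.log_pos ?_
      rw [lt_div_iff₀ hδ]
      linarith
    have hlog2 : 0 < Real.log (4 * n * L / δ) := by
      refine Real.log_pos ?_
      rw [lt_div_iff₀ hδ]
      nlinarith
    set l₂ := Real.log (4 * n * L / δ) with hl₂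
    have hden : 0 < ε ^ 2 - ε ^ 3 / 3 := by nlinarith [sq_pos_of_pos hε]
    set b : ℝ := (1 + √(8 * l₂)) ^ 2 with hb
    have hbpos : 0 < b := by positivity
    have hb8 : 8 * l₂ ≤ b := by
      have h1 := Real.sq_sqrt (show 0 ≤ 8 * l₂ by linarith)
      have h2 := Real.sqrt_nonneg (8 * l₂)
      nlinarith
    have hK0 : 0 < K := by
      have : (0 : ℝ) < K := lt_of_lt_of_le (by positivity) hK
      exact_mod_cast this
    refine hA' (hV.norm_sq_ae_eq hK0) fun M => ?_
    refine (hV.measure_norm_mul_le hn hK0 M hε hε1 hbpos).trans ?_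
    set x : ℝ := δ / (4 * n * L) with hx
    have hxpos : 0 < x := by positivity
    have h4nx : 4 * n * x = δ / L := by
      rw [hx]
      field_simp
    have hδL : δ / L ≤ 1 := by
      rw [div_le_one hL]
      linarith
    -- The square compensates the factor `4 * n ^ 2`: the flattening term is at most `δ / (4 * L)`
    -- and the sampling term at most `δ / (2 * L)`.
    have hexp1 : Real.exp (-(b / 2)) ≤ x ^ 2 := by
      refine Real.exp_neg_le_of_log_inv_le (by positivity) ?_
      rw [← inv_pow, Real.log_pow, hx, inv_div, ← hl₂]
      push_cast
      linarith
    have hexp2 : Real.exp (-(K * ε ^ 2 / (2 * b))) ≤ δ / (4 * L) := by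
      refine Real.exp_neg_le_of_log_inv_le (by positivity) ?_
      rw [inv_div, le_div_iff₀ (by positivity)]
      have h1 : 2 / ε ^ 2 ≤ 2 / (ε ^ 2 - ε ^ 3 / 3) :=
        div_le_div_of_nonneg_left (by norm_num) hden (by
          have : 0 < ε ^ 3 := by positivity
          linarith)
      have h2 : 2 / ε ^ 2 * Real.log (4 * L / δ) * b ≤ K :=
        le_trans (by gcongr) hK
      calc Real.log (4 * L / δ) * (2 * b) = 2 / ε ^ 2 * Real.log (4 * L / δ) * b * ε ^ 2 := by
            field_simp
        _ ≤ K * ε ^ 2 := by gcongr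
    have h5 : 4 * n ^ 2 * Real.exp (-(b / 2)) ≤ 4 * n ^ 2 * x ^ 2 := by gcongr
    have h6 : 4 * n ^ 2 * x ^ 2 = (δ / L) * (δ / L) / 4 := by
      rw [← h4nx]
      ring
    have h7 : (δ / L) * (δ / L) ≤ δ / L := mul_le_of_le_one_left (by positivity) hδL
    have h8 : δ / (4 * L) = δ / L / 4 := by
      field_simp
    have h9 : 0 < δ / L := by positivity
    linarith
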